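/- A $(0,1)$-matrix $M$ of size $n\times n$ is called \emph{indecomposable} if it has no $s\times(n-s)$ zero submatrix with $0<s<n$, and \emph{quadrangular} (or \emph{combinatorially orthogonal}) if the inner product of any two distinct rows, and of any two distinct columns, is not equal to $1$; the zero-pattern of every unitary matrix is quadrangular. The \emph{zero-pattern} (support) $\underline{X}$ of a matrix $X$ is the $(0,1)$-matrix with $\underline{X}_{i,j}=1$ if and only if $X_{i,j}\neq 0$. For $n\ge 2$, call an $n\times n$ $(0,1)$-matrix a \emph{maximal zero-pattern} if it is indecomposable, quadrangular, and has exactly $(n-2)^2$ zero entries. Proposition. Let $n\ge 2$. If $M$ is a maximal $n\times n$ zero-pattern, then there exists a rational orthogonal matrix $X\in O_n(\mathbb{Q})$ (that is, an $n\times n$ matrix with rational entries and $XX^{T}=I$) such that $\underline{X}=M$. -/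

import Mathlib

/-- The zero-pattern (support) of a matrix `X`: the `(0,1)`-matrix of the same size with a `1`
exactly where `X` has a nonzero entry. -/
def zeroPattern {m n : ℕ} {K : Type*} [Zero K] [DecidableEq K]
    (X : Matrix (Fin m) (Fin n) K) : Matrix (Fin m) (Fin n) ℕ :=
  fun i j => if X i j ≠ 0 then 1 else 0

/-- A `(0,1)`-matrix. -/
def IsZeroOneMatrix {m n : ℕ} (M : Matrix (Fin m) (Fin n) ℕ) : Prop :=
  ∀ i j, M i j = 0 ∨ M i j = 1

/-- An `n × n` matrix is decomposable if it contains an `s × (n - s)` zero submatrix for some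
`0 < s < n` (rows indexed by `R`, columns indexed by `C`, not necessarily contiguous). -/
def IsDecomposable {n : ℕ} (M : Matrix (Fin n) (Fin n) ℕ) : Prop :=
  ∃ (s : ℕ) (R C : Finset (Fin n)), 0 < s ∧ s < n ∧ R.card = s ∧ C.card = n - s ∧
    ∀ i ∈ R, ∀ j ∈ C, M i j = 0

/-- An indecomposable square matrix. -/
def IsIndecomposable {n : ℕ} (M : Matrix (Fin n) (Fin n) ℕ) : Prop :=
  ¬ IsDecomposable M

/-- A `(0,1)`-matrix is quadrangular (combinatorially orthogonal) if the inner product of any two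
distinct rows, and of any two distinct columns, is not `1`. -/
def IsQuadrangular {m n : ℕ} (M : Matrix (Fin m) (Fin n) ℕ) : Prop :=
  (∀ i i' : Fin m, i ≠ i' → ∑ k, M i k * M i' k ≠ 1) ∧
    (∀ j j' : Fin n, j ≠ j' → ∑ k, M k j * M k j' ≠ 1)

/-- The number of zero entries of a matrix. -/
def numZeros {m n : ℕ} (M : Matrix (Fin m) (Fin n) ℕ) : ℕ :=
  (Finset.univ.filter fun p : Fin m × Fin n => M p.1 p.2 = 0).card

/-- A maximal zero-pattern of size `n` (used for `n ≥ 2`): an indecomposable quadrangular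
`(0,1)`-matrix with exactly `(n - 2) ^ 2` zero entries. -/
structure IsMaximalZeroPattern {n : ℕ} (M : Matrix (Fin n) (Fin n) ℕ) : Prop where
  isZeroOne : IsZeroOneMatrix M
  indecomposable : IsIndecomposable M
  quadrangular : IsQuadrangular M
  numZeros_eq : numZeros M = (n - 2) ^ 2

/-!
Rows and columns of `M` are the vertices of a bipartite graph in which no two vertices have exactly
one common neighbour. A four-cycle has `2 * (#edges - 2 * #vertices) = -8`, and it can be grown to
the whole graph without decreasing this quantity, adding either a vertex with two neighbours or,
when there is none, all vertices of the outer boundary. So the quantity is always at least `-8`, and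
maximal zero-patterns are the case of equality.

If all degrees are at least three, equality in the growth argument forces order `4` and exactly one
zero in each line, and a matrix of quaternion multiplication does the job. Otherwise, up to
transposition, some row has exactly two ones; quadrangularity makes its two columns equal. Splitting
these twin columns would produce a graph violating the bound unless any two rows meeting them have a
further column in common. Hence deleting the row and one of the two columns leaves a maximal
zero-pattern. Its orthogonal realization, bordered by a `1` and rotated in the plane of the two
columns with cosine `3 / 5` and sine `4 / 5`, realizes `M`.
-/

open Finset

section Graph

variable {V : Type*} {G : SimpleGraph V} {S T H : Finset V} {x y s t : V}

open Classical in
/-- The neighbours of `x` that lie in `S`. -/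
noncomputable def nbrsIn (G : SimpleGraph V) (S : Finset V) (x : V) : Finset V :=
  {y ∈ S | G.Adj x y}

/-- Twice the difference between the number of edges of the induced subgraph `G[S]` and `2 * #S`,
written as a sum over the vertices of `S`. -/
noncomputable def surplus (G : SimpleGraph V) (S : Finset V) : ℤ :=
  ∑ x ∈ S, ((#(nbrsIn G S x) : ℤ) - 4)

/-- The induced subgraph `G[S]` has minimum degree at least two. -/
def MinDegreeTwoOn (G : SimpleGraph V) (S : Finset V) : Prop :=
  ∀ s ∈ S, 2 ≤ #(nbrsIn G S s)

/-- No vertex outside `S` has two neighbours in `S`. -/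
def IsTwoClosed (G : SimpleGraph V) (S : Finset V) : Prop :=
  ∀ x ∉ S, #(nbrsIn G S x) ≤ 1

/-- A connected graph in which no two distinct vertices have exactly one common neighbour. The
bipartite graph of an indecomposable quadrangular matrix has this property. -/
structure IsQuadrangularGraph (G : SimpleGraph V) : Prop where
  connected : G.Connected
  exists_ne_common : ∀ {x y s : V}, x ≠ y → G.Adj x s → G.Adj y s →
    ∃ t, t ≠ s ∧ G.Adj x t ∧ G.Adj y t

@[simp]
theorem mem_nbrsIn : y ∈ nbrsIn G S x ↔ y ∈ S ∧ G.Adj x y := by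
  simp [nbrsIn]

theorem nbrsIn_mono (h : S ⊆ T) (x : V) : nbrsIn G S x ⊆ nbrsIn G T x := fun y hy => by
  rw [mem_nbrsIn] at hy ⊢
  exact ⟨h hy.1, hy.2⟩

theorem card_nbrsIn_mono (h : S ⊆ T) (x : V) : #(nbrsIn G S x) ≤ #(nbrsIn G T x) :=
  card_le_card (nbrsIn_mono h x)

theorem card_nbrsIn_union [DecidableEq V] (h : Disjoint S H) (x : V) :
    #(nbrsIn G (S ∪ H) x) = #(nbrsIn G S x) + #(nbrsIn G H x) := by
  classical
  simp only [nbrsIn, filter_union, card_union_of_disjoint (disjoint_filter_filter h)]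

theorem sum_card_nbrsIn_comm (G : SimpleGraph V) (S H : Finset V) :
    ∑ x ∈ S, #(nbrsIn G H x) = ∑ x ∈ H, #(nbrsIn G S x) := by
  classical
  simpa only [bipartiteAbove, bipartiteBelow, nbrsIn, G.adj_comm] using
    sum_card_bipartiteAbove_eq_sum_card_bipartiteBelow G.Adj (s := S) (t := H)

theorem surplus_union [DecidableEq V] (h : Disjoint S H) :
    surplus G (S ∪ H) =
      surplus G S + ∑ x ∈ H, ((#(nbrsIn G (S ∪ H) x) : ℤ) + #(nbrsIn G S x) - 4) := by
  have hcomm : ∑ x ∈ S, (#(nbrsIn G H x) : ℤ) = ∑ x ∈ H, (#(nbrsIn G S x) : ℤ) :=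
    mod_cast sum_card_nbrsIn_comm G S H
  simp only [surplus, sum_union h, card_nbrsIn_union h, Nat.cast_add, sum_sub_distrib,
    sum_add_distrib, hcomm]
  ring

theorem surplus_univ [Fintype V] [DecidableRel G.Adj] :
    surplus G univ = #{p : V × V | G.Adj p.1 p.2} - 4 * (Fintype.card V : ℤ) := by
  have hcard : #{p : V × V | G.Adj p.1 p.2} = ∑ x, #(nbrsIn G univ x) := by
    simp only [card_filter, Fintype.sum_prod_type, nbrsIn]
    exact sum_congr rfl fun x _ => sum_congr rfl fun y _ => by congr
  rw [surplus, hcard, sum_sub_distrib, sum_const, card_univ, nsmul_eq_mul, mul_comm, Nat.cast_sum]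

theorem card_nbrsIn_insert_self [DecidableEq V] :
    #(nbrsIn G (insert x S) x) = #(nbrsIn G S x) := by
  simp [nbrsIn, filter_insert]

theorem surplus_insert [DecidableEq V] (hx : x ∉ S) :
    surplus G (insert x S) = surplus G S + (2 * #(nbrsIn G S x) - 4) := by
  have h := surplus_union (G := G) (disjoint_singleton_right.2 hx)
  rw [union_comm, ← insert_eq, sum_singleton, card_nbrsIn_insert_self] at h
  linarith

namespace MinDegreeTwoOn

theorem neg_two_mul_card_le_surplus (hS : MinDegreeTwoOn G S) : -(2 * #S : ℤ) ≤ surplus G S := by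
  have h := sum_le_sum (f := fun _ => (-2 : ℤ)) (g := fun x => (#(nbrsIn G S x) : ℤ) - 4)
    (s := S) fun x hx => by have := hS x hx; omega
  rw [sum_const, nsmul_eq_mul] at h
  rw [surplus]
  linarith

theorem union [DecidableEq V] (hS : MinDegreeTwoOn G S)
    (hH : ∀ x ∈ H, 2 ≤ #(nbrsIn G (S ∪ H) x)) : MinDegreeTwoOn G (S ∪ H) := fun x hx =>
  (mem_union.1 hx).elim (fun h => (hS x h).trans (card_nbrsIn_mono subset_union_left x)) (hH x)

theorem insert [DecidableEq V] (hS : MinDegreeTwoOn G S) (hx : 2 ≤ #(nbrsIn G S x)) :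
    MinDegreeTwoOn G (insert x S) := by
  rw [insert_eq, union_comm]
  refine hS.union fun y hy => ?_
  obtain rfl := mem_singleton.1 hy
  exact hx.trans (card_nbrsIn_mono subset_union_left y)

end MinDegreeTwoOn

/-- The vertices outside `S` that have a neighbour in `S`. -/
noncomputable def outerBoundary [Fintype V] (G : SimpleGraph V) (S : Finset V) : Finset V :=
  open Classical in {x | x ∉ S ∧ ∃ s ∈ S, G.Adj x s}

@[simp]
theorem mem_outerBoundary [Fintype V] : x ∈ outerBoundary G S ↔ x ∉ S ∧ ∃ s ∈ S, G.Adj x s := by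
  simp [outerBoundary]

theorem disjoint_outerBoundary [Fintype V] : Disjoint S (outerBoundary G S) :=
  disjoint_left.2 fun _ hS hB => (mem_outerBoundary.1 hB).1 hS

namespace IsTwoClosed

theorem eq_of_adj (hS : IsTwoClosed G S) (hx : x ∉ S) (hs : s ∈ S) (ht : t ∈ S)
    (hxs : G.Adj x s) (hxt : G.Adj x t) : s = t :=
  card_le_one.1 (hS x hx) s (mem_nbrsIn.2 ⟨hs, hxs⟩) t (mem_nbrsIn.2 ⟨ht, hxt⟩)

theorem card_nbrsIn_eq_one [Fintype V] (hS : IsTwoClosed G S) (hx : x ∈ outerBoundary G S) :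
    #(nbrsIn G S x) = 1 := by
  obtain ⟨hxS, s, hs, hxs⟩ := mem_outerBoundary.1 hx
  exact le_antisymm (hS x hxS) (card_pos.2 ⟨s, mem_nbrsIn.2 ⟨hs, hxs⟩⟩)

theorem surplus_union_outerBoundary [Fintype V] [DecidableEq V] (hS : IsTwoClosed G S) :
    surplus G (S ∪ outerBoundary G S) =
      surplus G S + ∑ x ∈ outerBoundary G S, ((#(nbrsIn G (outerBoundary G S) x) : ℤ) - 2) := by
  rw [surplus_union disjoint_outerBoundary]
  refine congrArg _ (sum_congr rfl fun x hx => ?_)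
  rw [card_nbrsIn_union disjoint_outerBoundary, hS.card_nbrsIn_eq_one hx]
  push_cast
  ring

end IsTwoClosed

namespace IsQuadrangularGraph

theorem forall_of_adj (hG : IsQuadrangularGraph G) {P : V → Prop}
    (hP : ∀ x y, G.Adj x y → P x → P y) (hx : P x) (y : V) : P y := by
  have h := SimpleGraph.reachable_iff_reflTransGen x y |>.1 (hG.connected.preconnected x y)
  induction h with
  | refl => exact hx
  | tail _ hadj ih => exact hP _ _ hadj ih

theorem outerBoundary_nonempty [Fintype V] (hG : IsQuadrangularGraph G) (hS : S.Nonempty)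
    (hne : S ≠ univ) : (outerBoundary G S).Nonempty := by
  obtain ⟨s, hs⟩ := hS
  by_contra hempty
  refine hne (eq_univ_of_forall (hG.forall_of_adj (P := (· ∈ S)) (fun x y hxy hx => ?_) hs))
  by_contra hy
  exact hempty ⟨y, mem_outerBoundary.2 ⟨hy, x, hx, hxy.symm⟩⟩

/-- Around a boundary vertex `x` over `s`, the boundary covers the neighbourhood of `s`: the path
`x s t` lies in a four-cycle, whose fourth vertex is `g t`. -/
theorem exists_lift [Fintype V] (hG : IsQuadrangularGraph G) (hS : IsTwoClosed G S)
    (hx : x ∉ S) (hs : s ∈ S) (hxs : G.Adj x s) :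
    ∃ g : V → V, Set.MapsTo g (nbrsIn G S s) (nbrsIn G (outerBoundary G S) x) ∧
      Set.InjOn g (nbrsIn G S s) ∧ ∀ t ∈ nbrsIn G S s, G.Adj (g t) t := by
  have hlift : ∀ t ∈ nbrsIn G S s, ∃ y ∈ nbrsIn G (outerBoundary G S) x, y ∉ S ∧ G.Adj y t := by
    intro t ht
    rw [mem_nbrsIn] at ht
    obtain ⟨y, hys, hxy, hty⟩ :=
      hG.exists_ne_common (ne_of_mem_of_not_mem ht.1 hx).symm hxs ht.2.symm
    have hyS : y ∉ S := fun hy => hys (hS.eq_of_adj hx hy hs hxy hxs)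
    exact ⟨y, mem_nbrsIn.2 ⟨mem_outerBoundary.2 ⟨hyS, t, ht.1, hty.symm⟩, hxy⟩, hyS, hty.symm⟩
  choose! g hg hgS hadj using hlift
  refine ⟨g, hg, fun t ht t' ht' h => ?_, hadj⟩
  exact hS.eq_of_adj (hgS t ht) (mem_nbrsIn.1 ht).1 (mem_nbrsIn.1 ht').1 (hadj t ht)
    (h ▸ hadj t' ht')

theorem card_nbrsIn_le_card_nbrsIn_outerBoundary [Fintype V] (hG : IsQuadrangularGraph G)
    (hS : IsTwoClosed G S) (hx : x ∉ S) (hs : s ∈ S) (hxs : G.Adj x s) :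
    #(nbrsIn G S s) ≤ #(nbrsIn G (outerBoundary G S) x) := by
  obtain ⟨g, hmaps, hinj, -⟩ := hG.exists_lift hS hx hs hxs
  exact card_le_card_of_injOn g hmaps hinj

theorem two_le_card_nbrsIn_outerBoundary [Fintype V] (hG : IsQuadrangularGraph G)
    (hS : IsTwoClosed G S) (hdeg : MinDegreeTwoOn G S) (hx : x ∈ outerBoundary G S) :
    2 ≤ #(nbrsIn G (outerBoundary G S) x) := by
  obtain ⟨hxS, s, hs, hxs⟩ := mem_outerBoundary.1 hx
  exact (hdeg s hs).trans (hG.card_nbrsIn_le_card_nbrsIn_outerBoundary hS hxS hs hxs)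

section

variable [Fintype V]

theorem ssubset_union_outerBoundary [DecidableEq V] (hG : IsQuadrangularGraph G) (hne : S.Nonempty)
    (huniv : S ≠ univ) : S ⊂ S ∪ outerBoundary G S := by
  obtain ⟨x, hx⟩ := hG.outerBoundary_nonempty hne huniv
  exact Finset.ssubset_iff_subset_ne.2 ⟨subset_union_left, fun h =>
    (mem_outerBoundary.1 hx).1 (h ▸ mem_union_right S hx)⟩

theorem surplus_le_surplus_union_outerBoundary [DecidableEq V] (hG : IsQuadrangularGraph G)
    (hS : IsTwoClosed G S) (hdeg : MinDegreeTwoOn G S) :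
    surplus G S ≤ surplus G (S ∪ outerBoundary G S) := by
  rw [hS.surplus_union_outerBoundary, le_add_iff_nonneg_right]
  refine sum_nonneg fun x hx => ?_
  have := hG.two_le_card_nbrsIn_outerBoundary hS hdeg hx
  omega

theorem minDegreeTwoOn_union_outerBoundary [DecidableEq V] (hG : IsQuadrangularGraph G)
    (hS : IsTwoClosed G S) (hdeg : MinDegreeTwoOn G S) :
    MinDegreeTwoOn G (S ∪ outerBoundary G S) :=
  hdeg.union fun x hx => (hG.two_le_card_nbrsIn_outerBoundary hS hdeg hx).trans
    (card_nbrsIn_mono subset_union_right x)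

theorem exists_ssubset_surplus_le (hG : IsQuadrangularGraph G) (hne : S.Nonempty)
    (huniv : S ≠ univ) (hdeg : MinDegreeTwoOn G S) :
    ∃ T, S ⊂ T ∧ MinDegreeTwoOn G T ∧ surplus G S ≤ surplus G T := by
  classical
  by_cases hS : IsTwoClosed G S
  · exact ⟨S ∪ outerBoundary G S, hG.ssubset_union_outerBoundary hne huniv,
      hG.minDegreeTwoOn_union_outerBoundary hS hdeg,
      hG.surplus_le_surplus_union_outerBoundary hS hdeg⟩
  · simp only [IsTwoClosed, not_forall, not_le] at hS
    obtain ⟨x, hx, hcard⟩ := hS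
    refine ⟨insert x S, ssubset_insert hx, hdeg.insert hcard, ?_⟩
    rw [surplus_insert hx]
    omega

theorem surplus_le_surplus_univ (hG : IsQuadrangularGraph G) (hne : S.Nonempty)
    (hdeg : MinDegreeTwoOn G S) : surplus G S ≤ surplus G univ := by
  obtain ⟨T, hST, ⟨hTdeg, hle⟩, hmax⟩ := Finite.exists_le_maximal
    (p := fun T => MinDegreeTwoOn G T ∧ surplus G S ≤ surplus G T) ⟨hdeg, le_rfl⟩
  by_cases huniv : T = univ
  · rwa [huniv] at hle
  · obtain ⟨T', hTT', hT'deg, hle'⟩ := hG.exists_ssubset_surplus_le (hne.mono hST) huniv hTdeg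
    exact absurd (hmax ⟨hT'deg, hle.trans hle'⟩ hTT'.subset) hTT'.not_subset

end

end IsQuadrangularGraph

/-- A set that already attains the lower bound `-8` for the surplus and from which the graph can be
grown without losing surplus; four-cycles are tight. -/
structure IsTight (G : SimpleGraph V) (S : Finset V) : Prop where
  nonempty : S.Nonempty
  minDegreeTwoOn : MinDegreeTwoOn G S
  neg_eight_le : -8 ≤ surplus G S

theorem isTight_fourCycle [DecidableEq V] {a b c d : V} (hab : a ≠ b) (hcd : c ≠ d)
    (hac : G.Adj a c) (had : G.Adj a d) (hbc : G.Adj b c) (hbd : G.Adj b d) :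
    IsTight G {a, b, c, d} := by
  have hpair : ∀ {S : Finset V} {x y z}, y ≠ z → y ∈ S → z ∈ S → G.Adj x y → G.Adj x z →
      2 ≤ #(nbrsIn G S x) := fun hyz hy hz hxy hxz =>
    one_lt_card.2 ⟨_, mem_nbrsIn.2 ⟨hy, hxy⟩, _, mem_nbrsIn.2 ⟨hz, hxz⟩, hyz⟩
  have hdeg : MinDegreeTwoOn G {a, b, c, d} := by
    simp only [MinDegreeTwoOn, forall_mem_insert, mem_singleton, forall_eq]
    exact ⟨hpair hcd (by simp) (by simp) hac had, hpair hcd (by simp) (by simp) hbc hbd,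
      hpair hab (by simp) (by simp) hac.symm hbc.symm,
      hpair hab (by simp) (by simp) had.symm hbd.symm⟩
  refine ⟨insert_nonempty _ _, hdeg, ?_⟩
  have hcard : #{a, b, c, d} ≤ 4 := card_le_four
  have := hdeg.neg_two_mul_card_le_surplus
  omega

theorem IsTight.insert_of_two_le_card [DecidableEq V] (hS : IsTight G S) (hx : x ∉ S)
    (hcard : 2 ≤ #(nbrsIn G S x)) : IsTight G (insert x S) where
  nonempty := insert_nonempty x S
  minDegreeTwoOn := hS.minDegreeTwoOn.insert hcard
  neg_eight_le := by
    have := hS.neg_eight_le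
    rw [surplus_insert hx]
    omega

namespace IsQuadrangularGraph

variable [Fintype V]

theorem exists_isTight (hG : IsQuadrangularGraph G) (h3 : 3 ≤ Fintype.card V) :
    ∃ S, IsTight G S ∧ #S ≤ 4 := by
  classical
  obtain ⟨a, b, c, hab, hac, hbc⟩ : ∃ a b c, a ≠ b ∧ G.Adj a c ∧ G.Adj b c := by
    by_contra! hunique
    have : Nontrivial V := Fintype.one_lt_card_iff_nontrivial.1 (by omega)
    obtain ⟨a⟩ := hG.connected.nonempty
    obtain ⟨b, hab⟩ := hG.connected.preconnected.exists_adj_of_nontrivial a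
    have hmem := hG.forall_of_adj (P := fun x => x = a ∨ x = b) (x := a) (fun x y hxy hx => by
      rcases hx with rfl | rfl
      · exact .inr (by_contra fun hy => hunique y b x hy hxy.symm hab.symm)
      · exact .inl (by_contra fun hy => hunique y a x hy hxy.symm hab)) (.inl rfl)
    have huniv : (univ : Finset V) = {a, b} := by
      ext x
      simp [hmem]
    have := card_le_two (a := a) (b := b)
    rw [← huniv, card_univ] at this
    omega
  obtain ⟨d, hdc, had, hbd⟩ := hG.exists_ne_common hab hac hbc
  exact ⟨{a, b, c, d}, isTight_fourCycle hab hdc.symm hac had hbc hbd, card_le_four⟩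

theorem neg_eight_le_surplus_univ (hG : IsQuadrangularGraph G) (h3 : 3 ≤ Fintype.card V) :
    -8 ≤ surplus G univ := by
  obtain ⟨S, hS, -⟩ := hG.exists_isTight h3
  exact hS.neg_eight_le.trans (hG.surplus_le_surplus_univ hS.nonempty hS.minDegreeTwoOn)

end IsQuadrangularGraph

end Graph

section Extremal

variable {V : Type*} [Fintype V] {G : SimpleGraph V} {S : Finset V} {x y s : V}

namespace IsTwoClosed

theorem exists_adj_outerBoundary (hG : IsQuadrangularGraph G) (hS : IsTwoClosed G S)
    (hne : (outerBoundary G S).Nonempty) (hs : s ∈ S) : ∃ x ∈ outerBoundary G S, G.Adj x s := by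
  obtain ⟨b, hb⟩ := hne
  refine hG.forall_of_adj (P := fun y => y ∈ S → ∃ x ∈ outerBoundary G S, G.Adj x y)
    (fun y z hyz hy hz => ?_) (fun hbS => absurd hbS (mem_outerBoundary.1 hb).1) s hs
  by_cases hyS : y ∈ S
  · obtain ⟨x, hx, hxy⟩ := hy hyS
    obtain ⟨g, hmaps, -, hadj⟩ := hG.exists_lift hS (mem_outerBoundary.1 hx).1 hyS hxy
    have hz' : z ∈ nbrsIn G S y := mem_nbrsIn.2 ⟨hz, hyz⟩
    exact ⟨g z, (mem_nbrsIn.1 (hmaps hz')).1, hadj z hz'⟩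
  · exact ⟨y, mem_outerBoundary.2 ⟨hyS, z, hz, hyz⟩, hyz⟩

theorem card_nbrsIn_outerBoundary_eq_two [DecidableEq V] (hG : IsQuadrangularGraph G)
    (hS : IsTwoClosed G S) (hdeg : MinDegreeTwoOn G S)
    (hle : surplus G (S ∪ outerBoundary G S) ≤ surplus G S)
    (hx : x ∈ outerBoundary G S) : #(nbrsIn G (outerBoundary G S) x) = 2 := by
  have hnonneg : ∀ y ∈ outerBoundary G S, 0 ≤ (#(nbrsIn G (outerBoundary G S) y) : ℤ) - 2 :=
    fun y hy => by
      have := hG.two_le_card_nbrsIn_outerBoundary hS hdeg hy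
      omega
  rw [hS.surplus_union_outerBoundary, add_le_iff_nonpos_right] at hle
  have := (sum_eq_zero_iff_of_nonneg hnonneg).1 (hle.antisymm (sum_nonneg hnonneg)) x hx
  omega

section

variable (hG : IsQuadrangularGraph G) (hS : IsTwoClosed G S) (hdeg : MinDegreeTwoOn G S)
  (hB : ∀ x ∈ outerBoundary G S, #(nbrsIn G (outerBoundary G S) x) = 2)

include hG hS hdeg hB

theorem card_nbrsIn_eq_two (hne : (outerBoundary G S).Nonempty) (hs : s ∈ S) :
    #(nbrsIn G S s) = 2 := by
  obtain ⟨x, hx, hxs⟩ := hS.exists_adj_outerBoundary hG hne hs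
  have hle := hG.card_nbrsIn_le_card_nbrsIn_outerBoundary hS (mem_outerBoundary.1 hx).1 hs hxs
  exact le_antisymm (hle.trans (hB x hx).le) (hdeg s hs)

theorem exists_bijOn_lift (hx : x ∈ outerBoundary G S) (hs : s ∈ S) (hxs : G.Adj x s) :
    ∃ g : V → V, Set.BijOn g (nbrsIn G S s) (nbrsIn G (outerBoundary G S) x) ∧
      ∀ t ∈ nbrsIn G S s, G.Adj (g t) t := by
  obtain ⟨g, hmaps, hinj, hadj⟩ := hG.exists_lift hS (mem_outerBoundary.1 hx).1 hs hxs
  have hcard : #(nbrsIn G (outerBoundary G S) x) ≤ #(nbrsIn G S s) := (hB x hx).le.trans (hdeg s hs)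
  exact ⟨g, ⟨hmaps, hinj, surjOn_of_injOn_of_card_le g hmaps hinj hcard⟩, hadj⟩

theorem eq_of_adj_of_mem_outerBoundary [DecidableEq V] (hx : x ∈ outerBoundary G S)
    (hy : y ∈ outerBoundary G S) (huniv : S ∪ outerBoundary G S = univ) (hs : s ∈ S)
    (hxs : G.Adj x s) (hys : G.Adj y s) : x = y := by
  by_contra hxy
  have hxS := (mem_outerBoundary.1 hx).1
  obtain ⟨z, hzs, hxz, hyz⟩ := hG.exists_ne_common hxy hxs hys
  have hzS : z ∉ S := fun hz => hzs (hS.eq_of_adj hxS hz hs hxz hxs)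
  have hzB : z ∈ outerBoundary G S := (mem_union.1 (huniv ▸ mem_univ z)).resolve_left hzS
  obtain ⟨g, hg, hgadj⟩ := hS.exists_bijOn_lift hG hdeg hB hx hs hxs
  obtain ⟨t, ht, rfl⟩ := hg.surjOn (mem_nbrsIn.2 ⟨hzB, hxz⟩)
  have htS := (mem_nbrsIn.1 ht).1
  obtain ⟨h, hh, hhadj⟩ := hS.exists_bijOn_lift hG hdeg hB hzB htS (hgadj t ht)
  have eq_lift : ∀ w ∈ outerBoundary G S, G.Adj w s → G.Adj (g t) w → w = h s :=
    fun w hw hws hzw => by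
      obtain ⟨a, ha, rfl⟩ := hh.surjOn (mem_nbrsIn.2 ⟨hw, hzw⟩)
      rw [hS.eq_of_adj (mem_outerBoundary.1 hw).1 (mem_nbrsIn.1 ha).1 hs (hhadj a ha) hws]
  exact hxy ((eq_lift x hx hxs hxz.symm).trans (eq_lift y hy hys hyz.symm).symm)

theorem card_outerBoundary_le [DecidableEq V] (huniv : S ∪ outerBoundary G S = univ) :
    #(outerBoundary G S) ≤ #S := by
  choose! p hp hadj using fun x (hx : x ∈ outerBoundary G S) => (mem_outerBoundary.1 hx).2
  refine card_le_card_of_injOn p hp fun x hx y hy hxy => ?_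
  exact hS.eq_of_adj_of_mem_outerBoundary hG hdeg hB hx hy huniv (hp x hx)
    (hadj x hx) (hxy ▸ hadj y hy)

end

end IsTwoClosed

theorem neg_card_le_surplus_univ (hdeg : ∀ x, 3 ≤ #(nbrsIn G univ x)) :
    -(Fintype.card V : ℤ) ≤ surplus G univ := by
  have h := sum_le_sum (s := univ) (f := fun _ => (-1 : ℤ))
    (g := fun x => (#(nbrsIn G univ x) : ℤ) - 4) fun x _ => by have := hdeg x; omega
  simpa [surplus] using h

namespace IsQuadrangularGraph

theorem exists_isTight_isTwoClosed [DecidableEq V] (hG : IsQuadrangularGraph G)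
    (hext : surplus G univ = -8) (hdeg : ∀ x, 3 ≤ #(nbrsIn G univ x)) :
    ∃ S, IsTight G S ∧ IsTwoClosed G S ∧ S ≠ univ ∧ S ∪ outerBoundary G S = univ := by
  have h8 := hext ▸ neg_card_le_surplus_univ hdeg
  obtain ⟨C, hC, hC4⟩ := hG.exists_isTight (by omega)
  have hCuniv : C ≠ univ := by
    rintro rfl
    rw [card_univ] at hC4
    omega
  obtain ⟨S, -, ⟨hS, hSuniv⟩, hmax⟩ :=
    Finite.exists_le_maximal (p := fun S => IsTight G S ∧ S ≠ univ) ⟨hC, hCuniv⟩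
  have hgrow : ∀ T, IsTight G T → S ⊂ T → T = univ := fun T hT hST =>
    by_contra fun hne => hST.not_subset (hmax ⟨hT, hne⟩ hST.subset)
  have hclosed : IsTwoClosed G S := by
    by_contra hnot
    simp only [IsTwoClosed, not_forall, not_le] at hnot
    obtain ⟨x, hx, hcard⟩ := hnot
    have huniv := hgrow _ (hS.insert_of_two_le_card hx hcard) (ssubset_insert hx)
    have h3 := hdeg x
    rw [← huniv, card_nbrsIn_insert_self] at h3
    rw [← huniv, surplus_insert hx] at hext
    have := hS.neg_eight_le
    omega
  refine ⟨S, hS, hclosed, hSuniv, hgrow _ ⟨hS.nonempty.mono subset_union_left, ?_, ?_⟩ ?_⟩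
  · exact hG.minDegreeTwoOn_union_outerBoundary hclosed hS.minDegreeTwoOn
  · exact hS.neg_eight_le.trans
      (hG.surplus_le_surplus_union_outerBoundary hclosed hS.minDegreeTwoOn)
  · exact hG.ssubset_union_outerBoundary hS.nonempty hSuniv

theorem card_eq_eight (hG : IsQuadrangularGraph G) (hext : surplus G univ = -8)
    (hdeg : ∀ x, 3 ≤ #(nbrsIn G univ x)) : Fintype.card V = 8 := by
  classical
  obtain ⟨S, hS, hclosed, hne, huniv⟩ := hG.exists_isTight_isTwoClosed hext hdeg
  have hS2 := hS.minDegreeTwoOn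
  have hB := fun x => hclosed.card_nbrsIn_outerBoundary_eq_two (x := x) hG hS2 <| by
    rw [huniv, hext]
    exact hS.neg_eight_le
  have hS4 : #S ≤ 4 := by
    have h2 := sum_congr (rfl : S = S) fun s hs => congrArg (fun n : ℕ => (n : ℤ) - 4) <|
      hclosed.card_nbrsIn_eq_two hG hS2 hB (hG.outerBoundary_nonempty hS.nonempty hne) hs
    have := hS.neg_eight_le
    rw [surplus, h2, sum_const, nsmul_eq_mul] at this
    push_cast at this
    omega
  have hle := hclosed.card_outerBoundary_le hG hS2 hB huniv
  have hcard : Fintype.card V = #S + #(outerBoundary G S) := by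
    rw [← card_union_of_disjoint disjoint_outerBoundary, huniv, card_univ]
  have h8 := hext ▸ neg_card_le_surplus_univ hdeg
  omega

theorem card_nbrsIn_univ_eq_three (hG : IsQuadrangularGraph G) (hext : surplus G univ = -8)
    (hdeg : ∀ x, 3 ≤ #(nbrsIn G univ x)) (x : V) : #(nbrsIn G univ x) = 3 := by
  have hsum : ∑ x, ((#(nbrsIn G univ x) : ℤ) - 3) = 0 := by
    have h8 := hG.card_eq_eight hext hdeg
    rw [surplus, sum_sub_distrib] at hext
    simp only [sum_sub_distrib, sum_const, card_univ, h8, nsmul_eq_mul] at hext ⊢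
    push_cast at hext ⊢
    linarith
  have := (sum_eq_zero_iff_of_nonneg fun y _ => by have := hdeg y; omega).1 hsum x (mem_univ x)
  omega

end IsQuadrangularGraph

end Extremal

section Twins

variable {V : Type*} {G : SimpleGraph V} {S : Finset V} {u v w x y z i j k : V}

/-- Distinct vertices with the same neighbours. -/
structure AreTwins (G : SimpleGraph V) (u v : V) : Prop where
  ne : u ≠ v
  adj_iff : ∀ x, G.Adj u x ↔ G.Adj v x

/-- The vertices `i` and `j` have a common neighbour other than `u` and `v`. -/
def IsLinked (G : SimpleGraph V) (u v i j : V) : Prop :=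
  ∃ w, w ≠ u ∧ w ≠ v ∧ G.Adj w i ∧ G.Adj w j

/-- The vertices `i` and `i'` lie in different components of the graph without `u` and `v`; the
predicate singles out a union of components. -/
def IsSeparated (G : SimpleGraph V) (u v i i' : V) : Prop :=
  ∃ P : V → Prop, P i ∧ ¬P i' ∧
    ∀ x y, x ≠ u → x ≠ v → y ≠ u → y ≠ v → G.Adj x y → (P x ↔ P y)

theorem IsLinked.symm (h : IsLinked G u v i j) : IsLinked G u v j i :=
  let ⟨w, hu, hv, hi, hj⟩ := h
  ⟨w, hu, hv, hj, hi⟩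

theorem IsTight.insert_of_adj [DecidableEq V] (hS : IsTight G S) (hx : x ∉ S) (hi : i ∈ S)
    (hj : j ∈ S) (hij : i ≠ j) (hxi : G.Adj x i) (hxj : G.Adj x j) : IsTight G (insert x S) :=
  hS.insert_of_two_le_card hx <| one_lt_card.2 ⟨i, by simp [*], j, by simp [*], hij⟩

theorem AreTwins.isTight [DecidableEq V] (huv : AreTwins G u v) (hij : i ≠ j) (hi : G.Adj u i)
    (hj : G.Adj u j) : IsTight G {u, v, i, j} :=
  isTight_fourCycle huv.ne hij hi hj ((huv.adj_iff i).1 hi) ((huv.adj_iff j).1 hj)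

section Fintype

variable [Fintype V]

theorem IsTight.card_nbrsIn_le_two (hG : IsQuadrangularGraph G) (hext : surplus G univ = -8)
    (hS : IsTight G S) (hx : x ∉ S) : #(nbrsIn G S x) ≤ 2 := by
  classical
  by_contra! h3
  have hle := hG.surplus_le_surplus_univ (insert_nonempty x S)
    (hS.minDegreeTwoOn.insert (x := x) (by omega))
  have := hS.neg_eight_le
  rw [hext, surplus_insert hx] at hle
  omega

theorem IsTight.false_of_adj_three (hG : IsQuadrangularGraph G) (hext : surplus G univ = -8)
    (hS : IsTight G S) (hx : x ∉ S) (hi : i ∈ S) (hj : j ∈ S) (hk : k ∈ S) (hij : i ≠ j)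
    (hik : i ≠ k) (hjk : j ≠ k) (hxi : G.Adj x i) (hxj : G.Adj x j) (hxk : G.Adj x k) : False :=
  (hS.card_nbrsIn_le_two hG hext hx).not_gt <| two_lt_card.2
    ⟨i, by simp [*], j, by simp [*], k, by simp [*], hij, hik, hjk⟩

namespace AreTwins

variable (hG : IsQuadrangularGraph G) (hext : surplus G univ = -8) (huv : AreTwins G u v)

include hG hext huv

theorem not_adj_of_adj (hi : G.Adj u i) (hwu : w ≠ u) (hwv : w ≠ v) (hwi : G.Adj w i) :
    ¬G.Adj u w := fun hw => by
  classical
  obtain ⟨t, htw, hut, hit⟩ := hG.exists_ne_common hi.ne hw hwi.symm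
  have hvi := (huv.adj_iff i).1 hi
  refine (huv.isTight htw.symm hw hut).false_of_adj_three hG hext (x := i) (i := u) (j := v)
    (k := w) ?_ (by simp) (by simp) (by simp) huv.ne hwu.symm hwv.symm hi.symm hvi.symm hwi.symm
  simp [hi.ne', hvi.ne', hwi.ne', hit.ne]

theorem false_of_adj_three (hi : G.Adj u i) (hj : G.Adj u j) (hk : G.Adj u k) (hij : i ≠ j)
    (hik : i ≠ k) (hjk : j ≠ k) (hwu : w ≠ u) (hwv : w ≠ v) (hwi : G.Adj w i) (hwj : G.Adj w j)
    (hwk : G.Adj w k) : False := by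
  classical
  have hvk := (huv.adj_iff k).1 hk
  have hS : IsTight G (insert w {u, v, i, j}) :=
    (huv.isTight hij hi hj).insert_of_adj (by simp [hwu, hwv, hwi.ne, hwj.ne]) (by simp) (by simp)
      hij hwi hwj
  refine hS.false_of_adj_three hG hext (x := k) (i := u) (j := v) (k := w) ?_ (by simp) (by simp)
    (by simp) huv.ne hwu.symm hwv.symm hk.symm hvk.symm hwk.symm
  simp [hwk.ne', hk.ne', hvk.ne', hik.symm, hjk.symm]

theorem isTight_of_adj_of_adj [DecidableEq V] {w' : V} (hi : G.Adj u i) (hj : G.Adj u j)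
    (hk : G.Adj u k) (hij : i ≠ j) (hik : i ≠ k) (hjk : j ≠ k) (hwu : w ≠ u) (hwv : w ≠ v)
    (hwi : G.Adj w i) (hwj : G.Adj w j) (hw'u : w' ≠ u) (hw'v : w' ≠ v) (hw'j : G.Adj w' j)
    (hw'k : G.Adj w' k) (hww' : w ≠ w') : IsTight G {w', k, w, u, v, i, j} := by
  have hwN := huv.not_adj_of_adj hG hext hi hwu hwv hwi
  have hw'N := huv.not_adj_of_adj hG hext hj hw'u hw'v hw'j
  have hvk := (huv.adj_iff k).1 hk
  have hS₁ : IsTight G {w, u, v, i, j} :=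
    (huv.isTight hij hi hj).insert_of_adj (by grind [G.ne_of_adj]) (by simp) (by simp) hij hwi hwj
  have hS₂ : IsTight G {k, w, u, v, i, j} :=
    hS₁.insert_of_adj (by grind [G.ne_of_adj]) (by simp) (by simp) huv.ne hk.symm hvk.symm
  exact hS₂.insert_of_adj (by grind [G.ne_of_adj]) (by simp) (by simp) hjk hw'j hw'k

/-- Among the neighbours of a pair of twins, the links form a matching: two incident links would let
a four-cycle grow to a tight set with a vertex outside sending three edges into it. -/
theorem false_of_isLinked_of_isLinked (hi : G.Adj u i) (hj : G.Adj u j) (hk : G.Adj u k)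
    (hij : i ≠ j) (hik : i ≠ k) (hjk : j ≠ k) (hlij : IsLinked G u v i j)
    (hljk : IsLinked G u v j k) : False := by
  classical
  obtain ⟨w, hwu, hwv, hwi, hwj⟩ := hlij
  obtain ⟨w', hw'u, hw'v, hw'j, hw'k⟩ := hljk
  have hB := fun {a b c d} => huv.false_of_adj_three hG hext (i := a) (j := b) (k := c) (w := d)
  have hwN := huv.not_adj_of_adj hG hext hi hwu hwv hwi
  have hww' : w ≠ w' := fun h => hB hi hj hk hij hik hjk hwu hwv hwi hwj (h ▸ hw'k)
  obtain ⟨x, hxj, hwx, hw'x⟩ := hG.exists_ne_common hww' hwj hw'j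
  have hxi : x ≠ i := fun h => hB hi hj hk hij hik hjk hw'u hw'v (h ▸ hw'x) hw'j hw'k
  have hxk : x ≠ k := fun h => hB hi hj hk hij hik hjk hwu hwv hwi hwj (h ▸ hwx)
  have hxu : x ≠ u := fun h => hwN (h ▸ hwx.symm)
  have hxv : x ≠ v := fun h => hwN ((huv.adj_iff w).2 (h ▸ hwx.symm))
  have hxN : ¬G.Adj u x := fun hx => hB hi hj hx hij hxi.symm hxj.symm hwu hwv hwi hwj hwx
  have hS : IsTight G {x, w', k, w, u, v, i, j} :=
    (huv.isTight_of_adj_of_adj hG hext hi hj hk hij hik hjk hwu hwv hwi hwj hw'u hw'v hw'j hw'k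
      hww').insert_of_adj (by simp [*, hwx.ne', hw'x.ne']) (by simp) (by simp) hww'
      hwx.symm hw'x.symm
  obtain ⟨y, hyw, hiy, hxy⟩ := hG.exists_ne_common hxi.symm hwi.symm hwx.symm
  have hyu : y ≠ u := fun h => hxN (h ▸ hxy.symm)
  have hyv : y ≠ v := fun h => hxN ((huv.adj_iff x).2 (h ▸ hxy.symm))
  have hyN := huv.not_adj_of_adj hG hext hi hyu hyv hiy.symm
  have hyw' : y ≠ w' := fun h => hB hi hj hk hij hik hjk hw'u hw'v (h ▸ hiy.symm) hw'j hw'k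
  have hyS : y ∉ ({x, w', k, w, u, v, i, j} : Finset V) := by
    have hyj : y ≠ j := fun h => hyN (h ▸ hj)
    have hyk : y ≠ k := fun h => hyN (h ▸ hk)
    simp [*, hiy.ne', hxy.ne']
  obtain ⟨m, hmi, hum, hym⟩ := hG.exists_ne_common hyu.symm hi hiy.symm
  by_cases hmS : m ∈ ({x, w', k, w, u, v, i, j} : Finset V)
  · exact hS.false_of_adj_three hG hext hyS (by simp) hmS (by simp) hmi.symm hxi.symm
      (fun h => hxN (h ▸ hum)) hiy.symm hym hxy.symm
  · exact (hS.insert_of_adj hyS (by simp) (by simp) hxi.symm hiy.symm hxy.symm).false_of_adj_three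
      hG hext (x := m) (i := u) (j := v) (k := y) (by simp [hym.ne', *]) (by simp)
      (by simp) (by simp) huv.ne hyu.symm hyv.symm hum.symm ((huv.adj_iff m).1 hum).symm hym.symm

end AreTwins

end Fintype

end Twins

section Split

variable {V : Type*} {G : SimpleGraph V} {W : Finset V} {P : V → Prop} {u v x y z i i' : V}

open Classical in
/-- The copy of `x` that receives the edge from `x` to `y` when every vertex of `W` is split in two:
`inl` for the edges to neighbours satisfying `P`, and `inr` for the remaining ones. -/
noncomputable def splitVertex (W : Finset V) (P : V → Prop) (x y : V) : V ⊕ W :=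
  if h : x ∈ W ∧ ¬P y then .inr ⟨x, h.1⟩ else .inl x

@[simp]
theorem elim_splitVertex : Sum.elim id (↑) (splitVertex W P x y) = x := by
  rw [splitVertex]
  split <;> rfl

/-- The graph obtained from `G` by splitting every vertex of `W` in two, distributing its edges
according to whether their other ends satisfy `P`. -/
def splitGraph (G : SimpleGraph V) (W : Finset V) (P : V → Prop) : SimpleGraph (V ⊕ W) where
  Adj a b := ∃ x y, G.Adj x y ∧ a = splitVertex W P x y ∧ b = splitVertex W P y x
  symm := ⟨fun _ _ ⟨x, y, h, ha, hb⟩ => ⟨y, x, h.symm, hb, ha⟩⟩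
  loopless := ⟨fun _ ⟨x, y, h, ha, hb⟩ =>
    h.ne (by simpa using congrArg (Sum.elim id (↑)) (ha.symm.trans hb))⟩

theorem splitVertex_of_notMem (hx : x ∉ W) : splitVertex W P x y = .inl x := by
  simp [splitVertex, hx]

theorem splitVertex_of_pos (hy : P y) : splitVertex W P x y = .inl x := by
  simp [splitVertex, hy]

theorem splitVertex_of_neg (hx : x ∈ W) (hy : ¬P y) : splitVertex W P x y = .inr ⟨x, hx⟩ := by
  simp [splitVertex, hx, hy]

theorem splitVertex_eq_iff : splitVertex W P x y = splitVertex W P x z ↔ (x ∈ W → (P y ↔ P z)) := by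
  by_cases hx : x ∈ W <;> by_cases hy : P y <;> by_cases hz : P z <;> simp [splitVertex, *]

theorem splitGraph_adj (h : G.Adj x y) :
    (splitGraph G W P).Adj (splitVertex W P x y) (splitVertex W P y x) :=
  ⟨x, y, h, rfl, rfl⟩

theorem surplus_splitGraph_le [Fintype V] :
    surplus (splitGraph G W P) univ ≤ surplus G univ - 4 * #W := by
  classical
  have hcard : #{p : (V ⊕ W) × (V ⊕ W) | (splitGraph G W P).Adj p.1 p.2} ≤
      #{p : V × V | G.Adj p.1 p.2} := by
    refine card_le_card_of_injOn (Prod.map (Sum.elim id (↑)) (Sum.elim id (↑))) ?_ ?_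
    · rintro ⟨a, b⟩ hab
      obtain ⟨x, y, hxy, rfl, rfl⟩ := (mem_filter.1 hab).2
      simpa using hxy
    · rintro ⟨a, b⟩ hab ⟨a', b'⟩ hab' h
      obtain ⟨x, y, -, rfl, rfl⟩ := (mem_filter.1 hab).2
      obtain ⟨x', y', -, rfl, rfl⟩ := (mem_filter.1 hab').2
      simp only [Prod.map_apply, elim_splitVertex, Prod.mk.injEq] at h
      rw [h.1, h.2]
  simp only [surplus_univ, Fintype.card_sum, Fintype.card_coe]
  push_cast
  linarith [(Nat.cast_le (α := ℤ)).2 hcard]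

theorem connected_splitGraph (hG : IsQuadrangularGraph G) (hi : ∀ x ∈ W, G.Adj x i) (hPi : P i)
    (hi' : ∀ x ∈ W, G.Adj x i') (hPi' : ¬P i')
    (hreach : (splitGraph G W P).Reachable (.inl i) (.inl i')) : (splitGraph G W P).Connected := by
  have hadj : ∀ x y, G.Adj x y → x ∉ W →
      (splitGraph G W P).Adj (.inl x) (splitVertex W P y x) := fun x y hxy hx =>
    splitVertex_of_notMem (P := P) hx ▸ splitGraph_adj hxy
  have hinl : ∀ x ∈ W, (splitGraph G W P).Reachable (.inl i) (.inl x) := fun x hx =>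
    (splitVertex_of_pos hPi ▸ hadj i x (hi x hx).symm fun h => (hi i h).ne rfl).reachable
  have hinr : ∀ x : W, (splitGraph G W P).Reachable (.inl i) (.inr x) := fun x =>
    hreach.trans (splitVertex_of_neg x.2 hPi' ▸
      hadj i' x (hi' x x.2).symm fun h => (hi' i' h).ne rfl).reachable
  have hall := hG.forall_of_adj (P := fun x => (splitGraph G W P).Reachable (.inl i) (.inl x))
    (fun x y hxy hx => ?_) (.refl _)
  · exact SimpleGraph.connected_iff_exists_forall_reachable _ |>.2
      ⟨.inl i, fun a => a.casesOn hall hinr⟩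
  · by_cases hy : y ∈ W
    · exact hinl y hy
    · refine .trans ?_ (hadj y x hxy.symm hy).symm.reachable
      rw [splitVertex]
      split
      · exact hinr _
      · exact hx

theorem exists_ne_common_splitGraph
    (h : ∀ x y z, x ≠ y → G.Adj x z → G.Adj y z → (z ∈ W → (P x ↔ P y)) →
      ∃ t, t ≠ z ∧ G.Adj x t ∧ G.Adj y t ∧ (x ∈ W ∨ y ∈ W → (P t ↔ P z)) ∧ (t ∈ W → (P x ↔ P y)))
    {a b c : V ⊕ W} (hab : a ≠ b) (hac : (splitGraph G W P).Adj a c)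
    (hbc : (splitGraph G W P).Adj b c) :
    ∃ d, d ≠ c ∧ (splitGraph G W P).Adj a d ∧ (splitGraph G W P).Adj b d := by
  obtain ⟨x, z, hxz, rfl, rfl⟩ := hac
  obtain ⟨y, z', hyz, rfl, hz⟩ := hbc
  obtain rfl : z = z' := by simpa using congrArg (Sum.elim id (↑)) hz
  have hxy : x ≠ y := fun h => hab (h ▸ rfl)
  obtain ⟨t, htz, hxt, hyt, hPt, hPxy⟩ := h x y z hxy hxz hyz (splitVertex_eq_iff.1 hz)
  refine ⟨splitVertex W P t x, fun h => htz ?_, ?_, ?_⟩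
  · simpa using congrArg (Sum.elim id (↑)) h
  · rw [splitVertex_eq_iff.2 fun hx => (hPt (.inl hx)).symm]
    exact splitGraph_adj hxt
  · rw [splitVertex_eq_iff.2 fun hy => (hPt (.inr hy)).symm, splitVertex_eq_iff.2 hPxy]
    exact splitGraph_adj hyt

theorem isSeparated_of_not_reachable [DecidableEq V]
    (h : ¬(splitGraph G {u, v} P).Reachable (.inl i) (.inl i')) : IsSeparated G u v i i' := by
  refine ⟨fun x => (splitGraph G {u, v} P).Reachable (.inl i) (.inl x), .refl _, h,
    fun x y hxu hxv hyu hyv hxy => ?_⟩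
  have hadj := splitGraph_adj (W := {u, v}) (P := P) hxy
  rw [splitVertex_of_notMem (by simp [hxu, hxv]),
    splitVertex_of_notMem (by simp [hyu, hyv])] at hadj
  exact ⟨fun h => h.trans hadj.reachable, fun h => h.trans hadj.symm.reachable⟩

namespace AreTwins

theorem adj_iff_of_mem [DecidableEq V] (huv : AreTwins G u v) (hx : x ∈ ({u, v} : Finset V))
    (y : V) : G.Adj x y ↔ G.Adj u y := by
  rcases mem_insert.1 hx with rfl | hx
  · rfl
  · rw [mem_singleton.1 hx, huv.adj_iff]

theorem exists_compatible_ne_common [DecidableEq V] (hG : IsQuadrangularGraph G)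
    (huv : AreTwins G u v)
    (hlink : ∀ x y, G.Adj u x → G.Adj u y → IsLinked G u v x y → (P x ↔ P y))
    (hside : ∀ x, G.Adj u x → ∃ y, y ≠ x ∧ G.Adj u y ∧ (P y ↔ P x))
    (hxy : x ≠ y) (hxz : G.Adj x z) (hyz : G.Adj y z) (hz : z ∈ ({u, v} : Finset V) → (P x ↔ P y)) :
    ∃ t, t ≠ z ∧ G.Adj x t ∧ G.Adj y t ∧
      (x ∈ ({u, v} : Finset V) ∨ y ∈ ({u, v} : Finset V) → (P t ↔ P z)) ∧
      (t ∈ ({u, v} : Finset V) → (P x ↔ P y)) := by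
  have hlinked : ∀ {w x y}, w ∉ ({u, v} : Finset V) → G.Adj u x → G.Adj u y → G.Adj w x →
      G.Adj w y → (P x ↔ P y) := fun hw hx hy hwx hwy => by
    simp only [mem_insert, mem_singleton, not_or] at hw
    exact hlink _ _ hx hy ⟨_, hw.1, hw.2, hwx, hwy⟩
  by_cases hboth : x ∈ ({u, v} : Finset V) ∧ y ∈ ({u, v} : Finset V)
  · obtain ⟨hx, hy⟩ := hboth
    obtain ⟨t, htz, hut, hPt⟩ := hside z ((huv.adj_iff_of_mem hx z).1 hxz)
    refine ⟨t, htz, (huv.adj_iff_of_mem hx t).2 hut, (huv.adj_iff_of_mem hy t).2 hut, fun _ => hPt,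
      fun ht => absurd ((huv.adj_iff_of_mem ht u).1 hut.symm) (G.loopless.irrefl u)⟩
  · obtain ⟨t, htz, hxt, hyt⟩ := hG.exists_ne_common hxy hxz hyz
    refine ⟨t, htz, hxt, hyt, ?_, fun ht => ?_⟩
    · have huniq : ∀ {x y}, x ∈ ({u, v} : Finset V) → y ∉ ({u, v} : Finset V) → G.Adj x t →
          G.Adj x z → G.Adj y t → G.Adj y z → (P t ↔ P z) := fun hx hy hxt hxz hyt hyz =>
        hlinked hy ((huv.adj_iff_of_mem hx t).1 hxt) ((huv.adj_iff_of_mem hx z).1 hxz) hyt hyz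
      rintro (hx | hy)
      · exact huniq hx (fun hy => hboth ⟨hx, hy⟩) hxt hxz hyt hyz
      · exact huniq hy (fun hx => hboth ⟨hx, hy⟩) hyt hyz hxt hxz
    · by_cases hzW : z ∈ ({u, v} : Finset V)
      · exact hz hzW
      · exact hlinked hzW ((huv.adj_iff_of_mem ht x).1 hxt.symm)
          ((huv.adj_iff_of_mem ht y).1 hyt.symm) hxz.symm hyz.symm

variable [Fintype V]

/-- Were the twins no cut, splitting them would give a quadrangular graph of too small a
surplus. -/
theorem isSeparated_of_forall_iff (hG : IsQuadrangularGraph G) (hext : surplus G univ = -8)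
    (huv : AreTwins G u v) (hi : G.Adj u i) (hi' : G.Adj u i') (hPi : P i) (hPi' : ¬P i')
    (hlink : ∀ x y, G.Adj u x → G.Adj u y → IsLinked G u v x y → (P x ↔ P y))
    (hside : ∀ x, G.Adj u x → ∃ y, y ≠ x ∧ G.Adj u y ∧ (P y ↔ P x)) :
    IsSeparated G u v i i' := by
  classical
  refine isSeparated_of_not_reachable (P := P) fun hreach => ?_
  have hconn := connected_splitGraph hG (fun x hx => (huv.adj_iff_of_mem hx i).2 hi) hPi
    (fun x hx => (huv.adj_iff_of_mem hx i').2 hi') hPi' hreach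
  have hsplit : IsQuadrangularGraph (splitGraph G {u, v} P) :=
    ⟨hconn, exists_ne_common_splitGraph fun _ _ _ => huv.exists_compatible_ne_common hG hlink hside⟩
  have hle := surplus_splitGraph_le (G := G) (W := {u, v}) (P := P)
  have hcard : 1 ≤ Fintype.card V := Fintype.card_pos_iff.2 ⟨u⟩
  have := hsplit.neg_eight_le_surplus_univ (by
    rw [Fintype.card_sum, Fintype.card_coe, card_pair huv.ne]
    omega)
  rw [hext, card_pair huv.ne] at hle
  omega

theorem isSeparated_of_not_isLinked (hG : IsQuadrangularGraph G) (hext : surplus G univ = -8)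
    (huv : AreTwins G u v) (hi : G.Adj u i) (hi' : G.Adj u i') (hii' : i ≠ i')
    (hlink : ¬IsLinked G u v i i') : IsSeparated G u v i i' := by
  by_cases hisol : ∀ w, w ≠ u → w ≠ v → ¬G.Adj w i
  · exact ⟨(· = i), rfl, hii'.symm, by grind [G.adj_comm]⟩
  by_cases hisol' : ∀ w, w ≠ u → w ≠ v → ¬G.Adj w i'
  · exact ⟨(· ≠ i'), hii', not_not.2 rfl, by grind [G.adj_comm]⟩
  push Not at hisol hisol'
  let P x := x = i ∨ IsLinked G u v i x
  have hPi' : ¬P i' := not_or.2 ⟨hii'.symm, hlink⟩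
  have hstep : ∀ x y, G.Adj u x → G.Adj u y → IsLinked G u v x y → P x → P y := by
    rintro x y hx hy hxy (rfl | hix)
    · exact .inr hxy
    · by_contra hPy
      have hyi : y ≠ i := fun h => hPy (.inl h)
      have hyx : y ≠ x := fun h => hPy (.inr (h ▸ hix))
      have hxi : x ≠ i := fun h => hPy (.inr (h ▸ hxy))
      exact huv.false_of_isLinked_of_isLinked hG hext hi hx hy hxi.symm hyi.symm hyx.symm hix hxy
  have hP : ∀ x y, G.Adj u x → G.Adj u y → IsLinked G u v x y → (P x ↔ P y) := fun x y hx hy hxy =>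
    ⟨hstep x y hx hy hxy, hstep y x hy hx hxy.symm⟩
  refine huv.isSeparated_of_forall_iff hG hext hi hi' (.inl rfl) hPi' hP fun x hx => ?_
  by_cases hout : ∃ w, w ≠ u ∧ w ≠ v ∧ G.Adj w x
  · obtain ⟨w, hwu, hwv, hwx⟩ := hout
    obtain ⟨y, hyx, huy, hwy⟩ := hG.exists_ne_common hwu.symm hx hwx
    exact ⟨y, hyx, huy, hP y x huy hx ⟨w, hwu, hwv, hwy, hwx⟩⟩
  · push Not at hout
    have hxi : x ≠ i := by
      rintro rfl
      exact hisol.elim fun w ⟨hu, hv, hw⟩ => hout w hu hv hw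
    have hxi' : x ≠ i' := by
      rintro rfl
      exact hisol'.elim fun w ⟨hu, hv, hw⟩ => hout w hu hv hw
    have hPx : ¬P x := not_or.2 ⟨hxi, fun ⟨w, hu, hv, _, hwx⟩ => hout w hu hv hwx⟩
    exact ⟨i', hxi'.symm, hi', iff_of_false hPi' hPx⟩

end AreTwins

end Split

section Bipartite

/-- The bipartite graph of a matrix: its vertices are the rows and the columns, joined by the
nonzero entries. -/
def bipartiteGraph {α β R : Type*} [Zero R] (M : Matrix α β R) : SimpleGraph (α ⊕ β) where
  Adj
    | .inl i, .inr j => M i j ≠ 0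
    | .inr j, .inl i => M i j ≠ 0
    | _, _ => False
  symm := ⟨by rintro (i | i) (j | j) h <;> exact h⟩
  loopless := ⟨by rintro (i | i) h <;> exact h⟩

section

variable {α β R : Type*} [Zero R] {M : Matrix α β R}

@[simp]
theorem bipartiteGraph_adj_inl_inr {i : α} {j : β} :
    (bipartiteGraph M).Adj (.inl i) (.inr j) ↔ M i j ≠ 0 := Iff.rfl

@[simp]
theorem bipartiteGraph_adj_inr_inl {i : α} {j : β} :
    (bipartiteGraph M).Adj (.inr j) (.inl i) ↔ M i j ≠ 0 := Iff.rfl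

@[simp]
theorem not_bipartiteGraph_adj_inl_inl {i i' : α} :
    ¬(bipartiteGraph M).Adj (.inl i) (.inl i') := id

@[simp]
theorem not_bipartiteGraph_adj_inr_inr {j j' : β} :
    ¬(bipartiteGraph M).Adj (.inr j) (.inr j') := id

end

theorem sum_eq_card_ne_zero {ι : Type*} [Fintype ι] {f : ι → ℕ} (hf : ∀ k, f k = 0 ∨ f k = 1) :
    ∑ k, f k = #{k | f k ≠ 0} := by
  rw [card_filter]
  exact sum_congr rfl fun k _ => by rcases hf k with h | h <;> simp [h]

theorem exists_ne_of_sum_mul_ne_one {ι : Type*} [Fintype ι] {f g : ι → ℕ}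
    (hf : ∀ k, f k = 0 ∨ f k = 1) (hg : ∀ k, g k = 0 ∨ g k = 1) (h : ∑ k, f k * g k ≠ 1) {k : ι}
    (hfk : f k ≠ 0) (hgk : g k ≠ 0) : ∃ l, l ≠ k ∧ f l ≠ 0 ∧ g l ≠ 0 := by
  by_contra! hunique
  refine h ?_
  rw [Fintype.sum_eq_single k fun l hl => ?_, (hf k).resolve_left hfk, (hg k).resolve_left hgk]
  by_cases hfl : f l = 0
  · rw [hfl, zero_mul]
  · rw [hunique l hl hfl, mul_zero]

namespace IsZeroOneMatrix

variable {m n : ℕ} {M : Matrix (Fin m) (Fin n) ℕ}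

theorem eq_one (h01 : IsZeroOneMatrix M) {i : Fin m} {j : Fin n} (hij : M i j ≠ 0) : M i j = 1 :=
  (h01 i j).resolve_left hij

theorem card_nbrsIn_inl (h01 : IsZeroOneMatrix M) (i : Fin m) :
    #(nbrsIn (bipartiteGraph M) univ (.inl i)) = ∑ j, M i j := by
  rw [sum_eq_card_ne_zero (h01 i), nbrsIn, card_filter, card_filter, Fintype.sum_sum_type]
  simp

theorem card_nbrsIn_inr (h01 : IsZeroOneMatrix M) (j : Fin n) :
    #(nbrsIn (bipartiteGraph M) univ (.inr j)) = ∑ i, M i j := by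
  rw [sum_eq_card_ne_zero fun i => h01 i j, nbrsIn, card_filter, card_filter, Fintype.sum_sum_type]
  simp

theorem surplus_bipartiteGraph (h01 : IsZeroOneMatrix M) :
    surplus (bipartiteGraph M) univ = 2 * ((∑ i, ∑ j, M i j : ℕ) : ℤ) - 4 * (m + n) := by
  simp only [surplus, Fintype.sum_sum_type, h01.card_nbrsIn_inl, h01.card_nbrsIn_inr,
    sum_sub_distrib, ← Nat.cast_sum, sum_const, card_univ, Fintype.card_sum, Fintype.card_fin,
    nsmul_eq_mul]
  rw [sum_comm (f := fun j i => M i j)]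
  push_cast
  ring

theorem numZeros_add_sum (h01 : IsZeroOneMatrix M) : numZeros M + ∑ i, ∑ j, M i j = m * n := by
  have h1 : ∀ i j, (if M i j = 0 then 1 else 0) + M i j = 1 := fun i j => by
    rcases h01 i j with h | h <;> simp [h]
  rw [numZeros, card_filter, Fintype.sum_prod_type, ← sum_add_distrib]
  simp only [← sum_add_distrib, h1]
  simp

theorem numZeros_eq_iff {M : Matrix (Fin n) (Fin n) ℕ} (h01 : IsZeroOneMatrix M) (hn : 2 ≤ n) :
    numZeros M = (n - 2) ^ 2 ↔ surplus (bipartiteGraph M) univ = -8 := by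
  have hsum := h01.numZeros_add_sum
  rw [h01.surplus_bipartiteGraph]
  obtain ⟨k, rfl⟩ := Nat.exists_eq_add_of_le hn
  rw [Nat.add_sub_cancel_left]
  zify at hsum ⊢
  constructor <;> intro h <;> linarith

end IsZeroOneMatrix

namespace IsIndecomposable

variable {n : ℕ} {M : Matrix (Fin n) (Fin n) ℕ} {R C : Finset (Fin n)}

theorem card_add_card_lt (hM : IsIndecomposable M) (hn : 2 ≤ n)
    (h0 : ∀ i ∈ R, ∀ j ∈ C, M i j = 0) (hR : R ≠ univ ∨ C.Nonempty) (hC : C ≠ univ ∨ R.Nonempty) :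
    #R + #C < n := by
  have hlt : ∀ S : Finset (Fin n), S ≠ univ → #S < n := fun S hS => by
    simpa using (card_lt_iff_ne_univ S).2 hS
  rcases R.eq_empty_or_nonempty with rfl | hRne
  · simpa using hlt C (hC.resolve_right not_nonempty_empty)
  rcases C.eq_empty_or_nonempty with rfl | hCne
  · simpa using hlt R (hR.resolve_right not_nonempty_empty)
  by_contra! hle
  have := hRne.card_pos
  have := hCne.card_pos
  obtain ⟨R', hR', hcardR⟩ := exists_subset_card_eq (s := R) (n := min #R (n - 1)) (by omega)
  obtain ⟨C', hC', hcardC⟩ := exists_subset_card_eq (s := C) (n := n - min #R (n - 1)) (by omega)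
  exact hM ⟨min #R (n - 1), R', C', by omega, by omega, hcardR, hcardC,
    fun i hi j hj => h0 i (hR' hi) j (hC' hj)⟩

theorem transpose (hM : IsIndecomposable M) : IsIndecomposable M.transpose := by
  rintro ⟨s, R, C, hs0, hsn, hR, hC, h0⟩
  exact hM ⟨n - s, C, R, by omega, by omega, hC, by omega, fun i hi j hj => h0 j hj i hi⟩

theorem connected_bipartiteGraph (hM : IsIndecomposable M) (hn : 2 ≤ n) :
    (bipartiteGraph M).Connected := by
  classical
  let i₀ : Fin n := ⟨0, by omega⟩
  let B := (bipartiteGraph M).Reachable (.inl i₀)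
  refine SimpleGraph.connected_iff_exists_forall_reachable _ |>.2 ⟨.inl i₀, ?_⟩
  by_contra hB
  have hadj : ∀ i j, M i j ≠ 0 → (B (.inl i) ↔ B (.inr j)) := fun i j hij =>
    have hadj : (bipartiteGraph M).Adj (.inl i) (.inr j) := hij
    ⟨fun h => h.trans hadj.reachable, fun h => h.trans hadj.symm.reachable⟩
  have hne : (∃ i, ¬B (.inl i)) ∨ ∃ j, ¬B (.inr j) := by
    simpa only [not_forall, Sum.exists] using hB
  have hi₀ : B (.inl i₀) := .refl _
  have hlt₁ := hM.card_add_card_lt hn (R := {i | B (.inl i)}) (C := {j | ¬B (.inr j)})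
    (by grind) (by simpa [filter_eq_self, filter_nonempty_iff] using hne)
    (.inr ⟨i₀, by simpa using hi₀⟩)
  have hlt₂ := hM.card_add_card_lt hn (R := {i | ¬B (.inl i)}) (C := {j | B (.inr j)})
    (by grind) (.inl fun h => (filter_eq_self.1 h i₀ (mem_univ i₀)) hi₀)
    (by simpa [filter_eq_self, filter_nonempty_iff, or_comm] using hne)
  have hcardR := card_filter_add_card_filter_not (s := univ) fun i => B (.inl i)
  have hcardC := card_filter_add_card_filter_not (s := univ) fun j => B (.inr j)
  rw [card_univ, Fintype.card_fin] at hcardR hcardC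
  omega

theorem two_le_sum_row (hM : IsIndecomposable M) (h01 : IsZeroOneMatrix M) (hn : 2 ≤ n)
    (i : Fin n) : 2 ≤ ∑ j, M i j := by
  have hlt := hM.card_add_card_lt hn (R := {i}) (C := {j | M i j = 0}) (by simp)
    (.inl ((card_lt_iff_ne_univ _).1 (by rw [card_singleton, Fintype.card_fin]; omega)))
    (.inr (singleton_nonempty i))
  have hcard := card_filter_add_card_filter_not (s := univ) fun j => M i j = 0
  rw [card_univ, Fintype.card_fin] at hcard
  rw [card_singleton] at hlt
  simp only [sum_eq_card_ne_zero (h01 i), ne_eq]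
  omega

end IsIndecomposable

theorem IsQuadrangular.isQuadrangularGraph {n : ℕ} {M : Matrix (Fin n) (Fin n) ℕ}
    (hM : IsQuadrangular M) (h01 : IsZeroOneMatrix M) (hind : IsIndecomposable M) (hn : 2 ≤ n) :
    IsQuadrangularGraph (bipartiteGraph M) where
  connected := hind.connected_bipartiteGraph hn
  exists_ne_common := by
    rintro (i | i) (i' | i') (s | s) hne hs hs'
    case inl.inl.inr =>
      obtain ⟨l, hl, h⟩ := exists_ne_of_sum_mul_ne_one (h01 i) (h01 i')
        (hM.1 i i' (by simpa using hne)) hs hs'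
      exact ⟨.inr l, by simpa using hl, h⟩
    case inr.inr.inl =>
      obtain ⟨l, hl, h⟩ := exists_ne_of_sum_mul_ne_one (fun k => h01 k i) (fun k => h01 k i')
        (hM.2 i i' (by simpa using hne)) hs hs'
      exact ⟨.inl l, by simpa using hl, h⟩
    all_goals simp at hs hs'

namespace IsMaximalZeroPattern

variable {n : ℕ} {M : Matrix (Fin n) (Fin n) ℕ}

theorem isQuadrangularGraph (hM : IsMaximalZeroPattern M) (hn : 2 ≤ n) :
    IsQuadrangularGraph (bipartiteGraph M) :=
  hM.quadrangular.isQuadrangularGraph hM.isZeroOne hM.indecomposable hn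

theorem surplus_eq (hM : IsMaximalZeroPattern M) (hn : 2 ≤ n) :
    surplus (bipartiteGraph M) univ = -8 :=
  (hM.isZeroOne.numZeros_eq_iff hn).1 hM.numZeros_eq

theorem transpose (hM : IsMaximalZeroPattern M) : IsMaximalZeroPattern M.transpose where
  isZeroOne i j := hM.isZeroOne j i
  indecomposable := hM.indecomposable.transpose
  quadrangular := ⟨hM.quadrangular.2, hM.quadrangular.1⟩
  numZeros_eq := by
    rw [← hM.numZeros_eq]
    exact card_equiv (Equiv.prodComm _ _) fun _ => by
      simp only [mem_filter_univ]
      exact Iff.rfl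

end IsMaximalZeroPattern

end Bipartite

section Reduction

namespace IsIndecomposable

variable {n : ℕ} {M : Matrix (Fin n) (Fin n) ℕ} {p v w i i' : Fin n}

theorem card_row_add_card_column_lt (hM : IsIndecomposable M) (hn : 2 ≤ n)
    (hp : ∀ j, j ≠ v → j ≠ w → M p j = 0) {P Q : Fin n → Prop} [DecidablePred P] [DecidablePred Q]
    (hPQ : ∀ r k, k ≠ v → k ≠ w → M r k ≠ 0 → P r → Q k) (hip : i ≠ p) (hi : ¬P i) :
    #{r | r = p ∨ P r} + #{k ∈ {v, w}ᶜ | ¬Q k} < n := by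
  refine hM.card_add_card_lt hn ?_ (.inl fun h => ?_) (.inr ⟨p, by simp⟩)
  · intro r hr k hk
    simp only [mem_filter, mem_univ, true_and, mem_compl, mem_insert, mem_singleton,
      not_or] at hr hk
    obtain ⟨⟨hkv, hkw⟩, hQk⟩ := hk
    by_contra hrk
    rcases hr with rfl | hPr
    · exact hrk (hp k hkv hkw)
    · exact hQk (hPQ r k hkv hkw hrk hPr)
  · exact (filter_eq_self.1 h i (mem_univ i)).elim hip hi

theorem not_isSeparated (hM : IsIndecomposable M) (hn : 2 ≤ n)
    (hp : ∀ j, j ≠ v → j ≠ w → M p j = 0) (hip : i ≠ p) (hi'p : i' ≠ p) :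
    ¬IsSeparated (bipartiteGraph M) (.inr v) (.inr w) (.inl i) (.inl i') := by
  classical
  rintro ⟨P, hi, hi', hP⟩
  have hiff : ∀ r k, k ≠ v → k ≠ w → M r k ≠ 0 → (P (.inl r) ↔ P (.inr k)) := fun r k hkv hkw h =>
    hP (.inl r) (.inr k) (by simp) (by simp) (by simpa using hkv) (by simpa using hkw) h
  have hlt := hM.card_row_add_card_column_lt hn hp (P := fun r => P (.inl r))
    (Q := fun k => P (.inr k)) (fun r k hkv hkw h => (hiff r k hkv hkw h).1) hi'p hi'
  have hlt' := hM.card_row_add_card_column_lt hn hp (P := fun r => ¬P (.inl r))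
    (Q := fun k => ¬P (.inr k)) (fun r k hkv hkw h => (not_congr (hiff r k hkv hkw h)).1) hip
    (not_not.2 hi)
  have hrows : #{r | r = p ∨ P (.inl r)} + #{r | r = p ∨ ¬P (.inl r)} = n + 1 := by
    rw [← card_union_add_card_inter, ← filter_or, ← filter_and]
    simp [← or_and_left, or_or_or_comm, em, filter_eq']
  have hcols := card_filter_add_card_filter_not (s := {v, w}ᶜ) fun k => P (.inr k)
  have hcompl := card_add_card_compl ({v, w} : Finset (Fin n))
  have hle : #({v, w} : Finset (Fin n)) ≤ 2 := card_le_two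
  rw [Fintype.card_fin] at hcompl
  simp only [not_not] at hlt'
  omega

theorem three_le_sum_column (hM : IsIndecomposable M) (h01 : IsZeroOneMatrix M) (hn : 3 ≤ n)
    (hvw : v ≠ w) (heq : ∀ i, M i v = M i w) : 3 ≤ ∑ i, M i v := by
  have hlt := hM.card_add_card_lt (by omega) (R := {i | M i v = 0}) (C := {v, w})
    (by grind) (.inr (insert_nonempty v {w}))
    (.inl ((card_lt_iff_ne_univ _).1 (by rw [card_pair hvw, Fintype.card_fin]; omega)))
  have hcard := card_filter_add_card_filter_not (s := univ) fun i => M i v = 0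
  rw [card_univ, Fintype.card_fin] at hcard
  rw [card_pair hvw] at hlt
  simp only [sum_eq_card_ne_zero fun i => h01 i v, ne_eq]
  omega

end IsIndecomposable

theorem IsQuadrangular.column_eq {m n : ℕ} {M : Matrix (Fin m) (Fin n) ℕ} {p : Fin m}
    {v w : Fin n} (hM : IsQuadrangular M) (h01 : IsZeroOneMatrix M)
    (hp : ∀ j, M p j ≠ 0 ↔ j = v ∨ j = w) (i : Fin m) : M i v = M i w := by
  have hpv : M p v ≠ 0 := (hp v).2 (.inl rfl)
  have hpw : M p w ≠ 0 := (hp w).2 (.inr rfl)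
  by_cases hip : i = p
  · rw [hip, h01.eq_one hpv, h01.eq_one hpw]
  have hcommon {j : Fin n} := exists_ne_of_sum_mul_ne_one (k := j) (h01 p) (h01 i)
    (hM.1 p i (Ne.symm hip))
  have hvw : M i v ≠ 0 → M i w ≠ 0 := fun hiv => by
    obtain ⟨l, hlv, hpl, hil⟩ := hcommon hpv hiv
    rwa [← ((hp l).1 hpl).resolve_left hlv]
  have hwv : M i w ≠ 0 → M i v ≠ 0 := fun hiw => by
    obtain ⟨l, hlw, hpl, hil⟩ := hcommon hpw hiw
    rwa [← ((hp l).1 hpl).resolve_right hlw]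
  rcases eq_or_ne (M i v) 0 with h | h
  · rw [h, not_not.1 (mt hwv (not_not.2 h))]
  · rw [h01.eq_one h, h01.eq_one (hvw h)]

theorem IsMaximalZeroPattern.exists_third_common {n : ℕ} {M : Matrix (Fin n) (Fin n) ℕ}
    {p v w i i' : Fin n} (hM : IsMaximalZeroPattern M) (hn : 2 ≤ n) (hvw : v ≠ w)
    (hp : ∀ j, M p j ≠ 0 ↔ j = v ∨ j = w) (hip : i ≠ p) (hi'p : i' ≠ p) (hii' : i ≠ i')
    (hi : M i v ≠ 0) (hi' : M i' v ≠ 0) : ∃ k, k ≠ v ∧ k ≠ w ∧ M i k ≠ 0 ∧ M i' k ≠ 0 := by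
  have htwins : AreTwins (bipartiteGraph M) (.inr v) (.inr w) := by
    refine ⟨by simpa using hvw, ?_⟩
    rintro (r | r) <;> simp [hM.quadrangular.column_eq hM.isZeroOne hp]
  have hzero : ∀ j, j ≠ v → j ≠ w → M p j = 0 := fun j hjv hjw =>
    by_contra fun hj => ((hp j).1 hj).elim hjv hjw
  by_contra! hnone
  refine hM.indecomposable.not_isSeparated hn hzero hip hi'p <|
    htwins.isSeparated_of_not_isLinked (hM.isQuadrangularGraph hn) (hM.surplus_eq hn) hi hi'
      (by simpa using hii') ?_
  rintro ⟨k | k, hkv, hkw, hik, hi'k⟩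
  · exact hik
  · exact hi'k (hnone k (by simpa using hkv) (by simpa using hkw) hik)

theorem IsZeroOneMatrix.exists_pair_of_sum_eq_two {m n : ℕ} {M : Matrix (Fin m) (Fin (n + 1)) ℕ}
    (h01 : IsZeroOneMatrix M) {p : Fin m} (hp : ∑ j, M p j = 2) :
    ∃ v u, ∀ j, M p j ≠ 0 ↔ j = v ∨ j = v.succAbove u := by
  rw [sum_eq_card_ne_zero (h01 p)] at hp
  obtain ⟨v, w, hvw, hsupport⟩ := card_eq_two.1 hp
  obtain ⟨u, rfl⟩ := Fin.exists_succAbove_eq hvw.symm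
  exact ⟨v, u, fun j => by simpa using Finset.ext_iff.1 hsupport j⟩

theorem sum_submatrix_succAbove {m n : ℕ} (M : Matrix (Fin (m + 1)) (Fin (n + 1)) ℕ)
    (p : Fin (m + 1)) (v : Fin (n + 1)) :
    ∑ i, ∑ j, M i j + M p v =
      ∑ j, M p j + ∑ i, M i v + ∑ i, ∑ j, M.submatrix p.succAbove v.succAbove i j := by
  rw [Fin.sum_univ_succAbove (fun i => ∑ j, M i j) p, Fin.sum_univ_succAbove (fun i => M i v) p]
  simp only [Fin.sum_univ_succAbove (fun j => M (p.succAbove _) j) v, sum_add_distrib,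
    Matrix.submatrix_apply]
  ring

namespace IsMaximalZeroPattern

variable {n : ℕ} {M : Matrix (Fin (n + 1)) (Fin (n + 1)) ℕ} {p v : Fin (n + 1)} {u : Fin n}

theorem isQuadrangular_submatrix (hM : IsMaximalZeroPattern M) (hn : 2 ≤ n + 1)
    (hp : ∀ j, M p j ≠ 0 ↔ j = v ∨ j = v.succAbove u) :
    IsQuadrangular (M.submatrix p.succAbove v.succAbove) := by
  have h01 := hM.isZeroOne
  refine ⟨fun i i' hii' => ?_, fun j j' hjj' => ?_⟩
  · have hne := hM.quadrangular.1 (p.succAbove i) (p.succAbove i') (by simpa using hii')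
    rw [Fin.sum_univ_succAbove _ v] at hne
    simp only [Matrix.submatrix_apply]
    by_cases hv : M (p.succAbove i) v * M (p.succAbove i') v = 0
    · rwa [hv, zero_add] at hne
    obtain ⟨hiv, hi'v⟩ := mul_ne_zero_iff.1 hv
    obtain ⟨k, hkv, hku, hik, hi'k⟩ := hM.exists_third_common hn (Fin.succAbove_ne v u).symm hp
      (Fin.succAbove_ne p i) (Fin.succAbove_ne p i') (by simpa using hii') hiv hi'v
    obtain ⟨l, rfl⟩ := Fin.exists_succAbove_eq hkv
    have hlu : l ≠ u := fun h => hku (h ▸ rfl)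
    rw [hM.quadrangular.column_eq h01 hp] at hiv hi'v
    have hle := sum_le_sum_of_subset (subset_univ {l, u})
      (f := fun j => M (p.succAbove i) (v.succAbove j) * M (p.succAbove i') (v.succAbove j))
    rw [sum_pair hlu, h01.eq_one hik, h01.eq_one hi'k, h01.eq_one hiv, h01.eq_one hi'v] at hle
    omega
  · have hne := hM.quadrangular.2 (v.succAbove j) (v.succAbove j') (by simpa using hjj')
    have hpair : M p (v.succAbove j) * M p (v.succAbove j') = 0 := by
      by_contra h
      obtain ⟨hj, hj'⟩ := mul_ne_zero_iff.1 h
      simp only [hp, Fin.succAbove_ne, false_or, Fin.succAbove_right_inj] at hj hj'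
      exact hjj' (hj.trans hj'.symm)
    rwa [Fin.sum_univ_succAbove _ p, hpair, zero_add] at hne

end IsMaximalZeroPattern

theorem IsIndecomposable.submatrix {n : ℕ} {M : Matrix (Fin (n + 1)) (Fin (n + 1)) ℕ}
    {p v : Fin (n + 1)} {u : Fin n} (hM : IsIndecomposable M)
    (hp : ∀ j, j ≠ v → j ≠ v.succAbove u → M p j = 0) (heq : ∀ i, M i v = M i (v.succAbove u)) :
    IsIndecomposable (M.submatrix p.succAbove v.succAbove) := by
  rintro ⟨s, R, C, hs0, hsn, hR, hC, h0⟩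
  have h0' : ∀ i ∈ R.map p.succAboveEmb, ∀ j ∈ C.map v.succAboveEmb, M i j = 0 := by
    simpa using h0
  have hpR : p ∉ R.map p.succAboveEmb := by simp [Fin.succAbove_ne]
  have hvC : v ∉ C.map v.succAboveEmb := by simp [Fin.succAbove_ne]
  have hRne : (R.map p.succAboveEmb).Nonempty := by
    rw [map_nonempty, ← card_pos]
    omega
  have hCne : (C.map v.succAboveEmb).Nonempty := by
    rw [map_nonempty, ← card_pos]
    omega
  by_cases hu : u ∈ C
  · have hlt := hM.card_add_card_lt (by omega) (R := R.map p.succAboveEmb)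
      (C := insert v (C.map v.succAboveEmb)) (fun i hi => (forall_mem_insert ..).2
        ⟨heq i ▸ h0' i hi _ (by simpa using hu), h0' i hi⟩)
      (.inr (insert_nonempty ..)) (.inr hRne)
    rw [card_insert_of_notMem hvC, card_map, card_map] at hlt
    omega
  · have hlt := hM.card_add_card_lt (by omega) (R := insert p (R.map p.succAboveEmb))
      (C := C.map v.succAboveEmb) ((forall_mem_insert ..).2
        ⟨fun j hj => hp j (fun h => hvC (h ▸ hj)) (fun h => hu (by simpa [h] using hj)), h0'⟩)
      (.inr hCne) (.inr (insert_nonempty ..))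
    rw [card_insert_of_notMem hpR, card_map, card_map] at hlt
    omega

theorem IsMaximalZeroPattern.submatrix {n : ℕ} {M : Matrix (Fin (n + 1)) (Fin (n + 1)) ℕ}
    {p v : Fin (n + 1)} {u : Fin n} (hM : IsMaximalZeroPattern M) (hn : 2 ≤ n)
    (hp : ∀ j, M p j ≠ 0 ↔ j = v ∨ j = v.succAbove u) :
    IsMaximalZeroPattern (M.submatrix p.succAbove v.succAbove) := by
  have h01 := hM.isZeroOne
  have heq := hM.quadrangular.column_eq h01 hp
  have hne : v ≠ v.succAbove u := (Fin.succAbove_ne v u).symm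
  have h01' : IsZeroOneMatrix (M.submatrix p.succAbove v.succAbove) := fun i j => h01 _ _
  have hind := hM.indecomposable.submatrix
    (fun j hjv hju => by_contra fun hj => ((hp j).1 hj).elim hjv hju) heq
  have hquad := hM.isQuadrangular_submatrix (by omega) hp
  refine ⟨h01', hind, hquad, (h01'.numZeros_eq_iff hn).2 (le_antisymm ?_ ?_)⟩
  · have hrow : ∑ j, M p j = 2 := by
      simp only [sum_eq_card_ne_zero (h01 p), hp, filter_or, filter_eq', mem_univ, if_true]
      exact card_pair hne
    have hcol := hM.indecomposable.three_le_sum_column h01 (by omega) hne heq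
    have hsum := sum_submatrix_succAbove M p v
    have hext := hM.surplus_eq (by omega)
    rw [h01.surplus_bipartiteGraph] at hext
    rw [h01'.surplus_bipartiteGraph]
    rw [h01.eq_one ((hp v).2 (.inl rfl)), hrow] at hsum
    omega
  · exact (hquad.isQuadrangularGraph h01' hind hn).neg_eight_le_surplus_univ (by simp; omega)

end Reduction

section Realization

/-- The matrix `M` is the zero-pattern of an orthogonal matrix with entries in `K`. -/
def IsOrthogonalPattern {n : ℕ} (K : Type*) [CommRing K] [DecidableEq K]
    (M : Matrix (Fin n) (Fin n) ℕ) : Prop :=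
  ∃ X ∈ Matrix.orthogonalGroup (Fin n) K, zeroPattern X = M

theorem IsOrthogonalPattern.transpose {n : ℕ} {K : Type*} [CommRing K] [DecidableEq K]
    {M : Matrix (Fin n) (Fin n) ℕ} (hM : IsOrthogonalPattern K M) :
    IsOrthogonalPattern K M.transpose := by
  obtain ⟨X, hX, rfl⟩ := hM
  refine ⟨X.transpose, ?_, rfl⟩
  rw [Matrix.mem_orthogonalGroup_iff, Matrix.transpose_transpose]
  exact (Matrix.mem_orthogonalGroup_iff' _ _).1 hX

theorem IsZeroOneMatrix.zeroPattern_eq_iff {m n : ℕ} {K : Type*} [Zero K] [DecidableEq K]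
    {M : Matrix (Fin m) (Fin n) ℕ} (h01 : IsZeroOneMatrix M) {X : Matrix (Fin m) (Fin n) K} :
    zeroPattern X = M ↔ ∀ i j, X i j ≠ 0 ↔ M i j ≠ 0 := by
  simp only [← Matrix.ext_iff, zeroPattern]
  refine forall₂_congr fun i j => ?_
  rcases h01 i j with h | h <;> simp [h]

theorem mem_orthogonalGroup_iff_dotProduct {ι K : Type*} [Fintype ι] [DecidableEq ι] [CommRing K]
    {X : Matrix ι ι K} :
    X ∈ Matrix.orthogonalGroup ι K ↔ ∀ i j, X i ⬝ᵥ X j = (1 : Matrix ι ι K) i j := by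
  rw [Matrix.mem_orthogonalGroup_iff, ← Matrix.ext_iff]
  rfl

section PlaneRotation

variable {ι K : Type*} [DecidableEq ι] [CommRing K]

/-- The rotation of the coordinate plane spanned by `v` and `w` with cosine `c` and sine `s`. -/
def planeRotation (c s : K) (v w : ι) (f : ι → K) : ι → K := fun j =>
  if j = v then c * f v + s * f w else if j = w then c * f w - s * f v else f j

variable [Fintype ι] {c s : K} {v w : ι}

theorem planeRotation_dotProduct (hcs : c ^ 2 + s ^ 2 = 1) (hvw : v ≠ w) (f g : ι → K) :
    planeRotation c s v w f ⬝ᵥ planeRotation c s v w g = f ⬝ᵥ g := by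
  rw [← sub_eq_zero, dotProduct, dotProduct, ← sum_sub_distrib, Fintype.sum_eq_add v w hvw]
  · simp only [planeRotation, if_true, if_neg hvw.symm]
    linear_combination (f v * g v + f w * g w) * hcs
  · rintro j ⟨hjv, hjw⟩
    simp only [planeRotation, if_neg hjv, if_neg hjw, sub_self]

theorem planeRotation_mem_orthogonalGroup (hcs : c ^ 2 + s ^ 2 = 1) (hvw : v ≠ w)
    {X : Matrix ι ι K} (hX : X ∈ Matrix.orthogonalGroup ι K) :
    Matrix.of (fun i => planeRotation c s v w (X i)) ∈ Matrix.orthogonalGroup ι K :=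
  mem_orthogonalGroup_iff_dotProduct.2 fun i j =>
    (planeRotation_dotProduct hcs hvw _ _).trans (mem_orthogonalGroup_iff_dotProduct.1 hX i j)

end PlaneRotation

section Bordered

variable {n : ℕ} {K : Type*} [CommRing K] {p v : Fin (n + 1)} {X : Matrix (Fin n) (Fin n) K}

/-- The matrix with a one in position `(p, v)`, zeros elsewhere in row `p` and column `v`, and `X`
in the remaining rows and columns. -/
def borderedMatrix (p v : Fin (n + 1)) (X : Matrix (Fin n) (Fin n) K) :
    Matrix (Fin (n + 1)) (Fin (n + 1)) K :=
  p.insertNth (Pi.single v 1) fun i => v.insertNth 0 (X i)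

@[simp]
theorem borderedMatrix_same : borderedMatrix p v X p = Pi.single v 1 := by
  simp [borderedMatrix]

@[simp]
theorem borderedMatrix_succAbove_same (i : Fin n) : borderedMatrix p v X (p.succAbove i) v = 0 := by
  simp [borderedMatrix]

@[simp]
theorem borderedMatrix_succAbove_succAbove (i j : Fin n) :
    borderedMatrix p v X (p.succAbove i) (v.succAbove j) = X i j := by
  simp [borderedMatrix]

theorem borderedMatrix_mem_orthogonalGroup (hX : X ∈ Matrix.orthogonalGroup (Fin n) K) :
    borderedMatrix p v X ∈ Matrix.orthogonalGroup (Fin (n + 1)) K := by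
  simp only [mem_orthogonalGroup_iff_dotProduct, Fin.forall_iff_succAbove p] at hX ⊢
  refine ⟨⟨by simp, fun i => ?_⟩, fun i => ⟨?_, fun i' => ?_⟩⟩
  · simp [Matrix.one_apply_ne (Fin.succAbove_ne p i).symm]
  · simp [Matrix.one_apply_ne (Fin.succAbove_ne p i)]
  · rw [dotProduct, Fin.sum_univ_succAbove _ v]
    simpa [dotProduct, Matrix.one_apply] using hX i i'

theorem planeRotation_borderedMatrix_ne_zero_iff [NoZeroDivisors K] {c s : K}
    (hc : c ≠ 0) (hs : s ≠ 0) {u : Fin n} {M : Matrix (Fin (n + 1)) (Fin (n + 1)) ℕ}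
    (hp : ∀ j, M p j ≠ 0 ↔ j = v ∨ j = v.succAbove u) (heq : ∀ i, M i v = M i (v.succAbove u))
    (hX : ∀ i j, X i j ≠ 0 ↔ M (p.succAbove i) (v.succAbove j) ≠ 0) (r j : Fin (n + 1)) :
    planeRotation c s v (v.succAbove u) (borderedMatrix p v X r) j ≠ 0 ↔ M r j ≠ 0 := by
  rcases Fin.eq_self_or_eq_succAbove p r with rfl | ⟨i, rfl⟩ <;>
    rcases Fin.eq_self_or_eq_succAbove v j with rfl | ⟨l, rfl⟩
  · simp [planeRotation, hp, hc]
  · by_cases hl : l = u <;> simp [planeRotation, hp, hs, hl]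
  · simp [planeRotation, heq, ← hX, hs]
  · by_cases hl : l = u <;> simp [planeRotation, ← hX, hc, hl]

end Bordered

theorem IsOrthogonalPattern.of_submatrix {n : ℕ} {K : Type*} [CommRing K] [DecidableEq K]
    [NoZeroDivisors K] {c s : K} (hcs : c ^ 2 + s ^ 2 = 1) (hc : c ≠ 0) (hs : s ≠ 0)
    {M : Matrix (Fin (n + 1)) (Fin (n + 1)) ℕ} {p v : Fin (n + 1)} {u : Fin n}
    (h01 : IsZeroOneMatrix M) (hp : ∀ j, M p j ≠ 0 ↔ j = v ∨ j = v.succAbove u)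
    (heq : ∀ i, M i v = M i (v.succAbove u))
    (hM : IsOrthogonalPattern K (M.submatrix p.succAbove v.succAbove)) :
    IsOrthogonalPattern K M := by
  obtain ⟨X, hX, hXM⟩ := hM
  have h01' : IsZeroOneMatrix (M.submatrix p.succAbove v.succAbove) := fun i j => h01 _ _
  exact ⟨_, planeRotation_mem_orthogonalGroup hcs (Fin.succAbove_ne v u).symm
    (borderedMatrix_mem_orthogonalGroup hX), h01.zeroPattern_eq_iff.2 <|
      planeRotation_borderedMatrix_ne_zero_iff hc hs hp heq (h01'.zeroPattern_eq_iff.1 hXM)⟩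

theorem IsMaximalZeroPattern.isOrthogonalPattern_of_sum_row_eq_two {n : ℕ}
    {M : Matrix (Fin (n + 1)) (Fin (n + 1)) ℕ} (hM : IsMaximalZeroPattern M) (hn : 2 ≤ n)
    (ih : ∀ N : Matrix (Fin n) (Fin n) ℕ, IsMaximalZeroPattern N → IsOrthogonalPattern ℚ N)
    {p : Fin (n + 1)} (hp : ∑ j, M p j = 2) : IsOrthogonalPattern ℚ M := by
  obtain ⟨v, u, hvu⟩ := hM.isZeroOne.exists_pair_of_sum_eq_two hp
  exact .of_submatrix (c := 3 / 5) (s := 4 / 5) (by norm_num) (by norm_num) (by norm_num)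
    hM.isZeroOne hvu (hM.quadrangular.column_eq hM.isZeroOne hvu) (ih _ (hM.submatrix hn hvu))

theorem IsMaximalZeroPattern.isOrthogonalPattern_two {M : Matrix (Fin 2) (Fin 2) ℕ}
    (hM : IsMaximalZeroPattern M) : IsOrthogonalPattern ℚ M := by
  have hne : ∀ i j, M i j ≠ 0 := fun i j => by
    have hzeros := hM.numZeros_eq
    rw [numZeros, Nat.sub_self, zero_pow two_ne_zero, card_eq_zero, filter_eq_empty_iff] at hzeros
    exact hzeros (mem_univ (i, j))
  refine ⟨!![3/5, 4/5; -4/5, 3/5], mem_orthogonalGroup_iff_dotProduct.2 ?_,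
    hM.isZeroOne.zeroPattern_eq_iff.2 fun i j => iff_of_true ?_ (hne i j)⟩
  · simp [Fin.forall_fin_two]
    norm_num
  · fin_cases i <;> fin_cases j <;> norm_num

/-- Left multiplication by the unit quaternion `-(i + 2j + 2k) / 3` in the basis `1, i, j, k`: an
orthogonal matrix that vanishes exactly on the diagonal. -/
def quaternionMatrix : Matrix (Fin 4) (Fin 4) ℚ :=
  !![0, 1/3, 2/3, 2/3; -1/3, 0, 2/3, -2/3; -2/3, -2/3, 0, 1/3; -2/3, 2/3, -1/3, 0]

theorem quaternionMatrix_mem_orthogonalGroup :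
    quaternionMatrix ∈ Matrix.orthogonalGroup (Fin 4) ℚ := by
  refine (Matrix.mem_orthogonalGroup_iff _ _).2 ?_
  ext i j
  fin_cases i <;> fin_cases j <;>
    simp [quaternionMatrix, Matrix.mul_apply, Fin.sum_univ_four] <;> norm_num

theorem quaternionMatrix_eq_zero_iff {i j : Fin 4} : quaternionMatrix i j = 0 ↔ i = j := by
  fin_cases i <;> fin_cases j <;> norm_num [quaternionMatrix]

theorem existsUnique_eq_zero_of_sum_add_one {ι : Type*} [Fintype ι] {f : ι → ℕ}
    (hf : ∀ k, f k = 0 ∨ f k = 1) (h : ∑ k, f k + 1 = Fintype.card ι) : ∃! k, f k = 0 := by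
  have hcard := card_filter_add_card_filter_not (s := univ) fun k => f k = 0
  rw [sum_eq_card_ne_zero hf, ← card_univ, ← hcard, add_comm, Nat.add_right_cancel_iff, eq_comm,
    card_eq_one_iff_existsUnique] at h
  simpa only [mem_filter_univ] using h

theorem IsZeroOneMatrix.exists_perm_eq_zero_iff {n : ℕ} {M : Matrix (Fin n) (Fin n) ℕ}
    (h01 : IsZeroOneMatrix M) (hrow : ∀ i, ∑ j, M i j + 1 = n) (hcol : ∀ j, ∑ i, M i j + 1 = n) :
    ∃ σ : Equiv.Perm (Fin n), ∀ i j, M i j = 0 ↔ σ i = j := by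
  choose σ hσ hσ_unique using fun i =>
    existsUnique_eq_zero_of_sum_add_one (h01 i) (by rw [hrow, Fintype.card_fin])
  have hinj : Function.Injective σ := fun i i' h =>
    (existsUnique_eq_zero_of_sum_add_one (fun k => h01 k (σ i))
      (by rw [hcol, Fintype.card_fin])).unique (hσ i) (h ▸ hσ i')
  exact ⟨.ofBijective σ (Finite.injective_iff_bijective.1 hinj), fun i j =>
    ⟨fun h => (hσ_unique i j h).symm, fun h => h ▸ hσ i⟩⟩

theorem IsZeroOneMatrix.isOrthogonalPattern_of_sum_eq_three {M : Matrix (Fin 4) (Fin 4) ℕ}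
    (h01 : IsZeroOneMatrix M) (hrow : ∀ i, ∑ j, M i j = 3) (hcol : ∀ j, ∑ i, M i j = 3) :
    IsOrthogonalPattern ℚ M := by
  obtain ⟨σ, hσ⟩ := h01.exists_perm_eq_zero_iff (fun i => congrArg Nat.succ (hrow i))
    fun j => congrArg Nat.succ (hcol j)
  refine ⟨quaternionMatrix.submatrix σ id, mem_orthogonalGroup_iff_dotProduct.2 fun i i' => ?_,
    h01.zeroPattern_eq_iff.2 fun i j => ?_⟩
  · simpa [dotProduct, Matrix.one_apply] using mem_orthogonalGroup_iff_dotProduct.1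
      quaternionMatrix_mem_orthogonalGroup (σ i) (σ i')
  · exact not_congr (quaternionMatrix_eq_zero_iff.trans (hσ i j).symm)

theorem IsMaximalZeroPattern.isOrthogonalPattern_of_three_le_degree {n : ℕ}
    {M : Matrix (Fin n) (Fin n) ℕ} (hM : IsMaximalZeroPattern M) (hn : 2 ≤ n)
    (hdeg : ∀ x, 3 ≤ #(nbrsIn (bipartiteGraph M) univ x)) : IsOrthogonalPattern ℚ M := by
  have hG := hM.isQuadrangularGraph hn
  have hext := hM.surplus_eq hn
  have h01 := hM.isZeroOne
  have hcard := hG.card_eq_eight hext hdeg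
  have hthree := hG.card_nbrsIn_univ_eq_three hext hdeg
  rw [Fintype.card_sum, Fintype.card_fin] at hcard
  obtain rfl : n = 4 := by omega
  exact h01.isOrthogonalPattern_of_sum_eq_three (fun i => h01.card_nbrsIn_inl i ▸ hthree (.inl i))
    fun j => h01.card_nbrsIn_inr j ▸ hthree (.inr j)

end Realization

theorem mainTheorem5 (n : ℕ) (hn : 2 ≤ n) (M : Matrix (Fin n) (Fin n) ℕ)
    (hM : IsMaximalZeroPattern M) :
    ∃ X : Matrix (Fin n) (Fin n) ℚ, X ∈ Matrix.orthogonalGroup (Fin n) ℚ ∧ zeroPattern X = M := by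
  change IsOrthogonalPattern ℚ M
  induction n, hn using Nat.le_induction with
  | base => exact hM.isOrthogonalPattern_two
  | succ n hn ih =>
    have hn' : 2 ≤ n + 1 := by omega
    by_cases hdeg : ∀ x, 3 ≤ #(nbrsIn (bipartiteGraph M) univ x)
    · exact hM.isOrthogonalPattern_of_three_le_degree hn' hdeg
    push Not at hdeg
    obtain ⟨p | p, hp⟩ := hdeg
    · rw [hM.isZeroOne.card_nbrsIn_inl] at hp
      have htwo := hM.indecomposable.two_le_sum_row hM.isZeroOne hn' p
      exact hM.isOrthogonalPattern_of_sum_row_eq_two hn ih (p := p) (by omega)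
    · rw [hM.isZeroOne.card_nbrsIn_inr] at hp
      have hMT := hM.transpose
      have htwo : 2 ≤ ∑ i, M i p := hMT.indecomposable.two_le_sum_row hMT.isZeroOne hn' p
      exact (hMT.isOrthogonalPattern_of_sum_row_eq_two hn ih
        (show ∑ i, M i p = 2 by omega)).transpose
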